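/- **Setting.** Let $\mathcal T$ be a finite rooted tree with root $s_0$, leaf set $\mathcal L$ and children sets $\mathcal C(s)$, whose internal nodes are labelled MAX or MIN, and let the root $s_0$ be an internal node labelled MAX. Consider a one-parameter exponential family on $\mathbb R$, $dP_\eta/d\nu(x)=e^{\eta x-b(\eta)}$, $\eta$ in the interior of the natural parameter space of $\nu$, let $X$ be the set of means of its members, and let $d(x,y)$ be the Kullback–Leibler divergence between the laws with means $x$ and $y$ (where for $x\notin X$, e.g. a sample mean at an end point of $X$, the law with mean $x$ is the point mass at $x$). For $\lambda\in X^{\mathcal L}$ let $V_s(\lambda)$ be the value of node $s$: $\lambda_s$ at a leaf, the maximum (minimum) of the values of the children at a MAX (MIN) node. Fix $\theta\in X$ and let $a_s(\lambda)$ be "win" if $V_s(\lambda)\ge\theta$ and "lose" otherwise. With $\mathcal D(s)$ the set of leaves below $s$ and $\Delta$ the simplex over $\mathcal L$, put $$\mathrm{Alt}_s(m)=\{\lambda\in X^{\mathcal D(s)}: a_s(\lambda)\ne a_{s_0}(m)\},\qquad d_{s_0}(m)=\max_{w\in\Delta}\ \inf_{\lambda\in \mathrm{Alt}_{s_0}(m)}\sum_{\ell\in\mathcal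 L}w_\ell\, d(m_\ell,\lambda_\ell).$$ Let $w(m)$ be a maximizer $w$ in the definition of $d_{s_0}(m)$. **Algorithm.** The leaves have unknown means $\mu=(\mu_\ell)\in X^{\mathcal L}$; draws of leaf $\ell$ return independent rewards with the member of the family with mean $\mu_\ell$ as law, independently over leaves. Let $N_\ell(t)$ and $\hat\mu_\ell(t)$ be the number of draws of $\ell$ and their sample mean after $t$ rounds. In the first $|\mathcal L|$ rounds each leaf is drawn once. In each later round $t$, if $N_\ell(t-1)<\sqrt t-|\mathcal L|/2$ for some $\ell$, a leaf minimizing $N_\ell(t-1)$ is drawn; otherwise a leaf maximizing $w_\ell(\hat\mu(t-1))/N_\ell(t-1)$ is drawn (ties, also in the choice of the maximizer $w(\hat\mu(t-1))$, are broken arbitrarily). Let $$Z_s(t)=\inf_{\lambda\in \mathrm{Alt}_s(\hat\mu(t))}\sum_{\ell\in\mathcal D(s)}N_\ell(t)\,d(\hat\mu_\ell(t),\lambda_\ell),\qquad Z^{\mathrm{GAI}}_{s_0}(t)=\begin{cases}\max_{c\in\mathcal C(s_0)}Z_c(t)&\text{if } V_{s_0}(\hat\mu(t))\ge\theta,\\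 Z_{s_0}(t)&\text{if } V_{s_0}(\hat\mu(t))<\theta.\end{cases}$$ The algorithm stops at the first round $\tau_\delta=\inf\{t>|\mathcal L|: Z^{\mathrm{GAI}}_{s_0}(t)\ge\beta(t,\delta)\}$, where $$\beta(t,\delta)=3\sum_{\ell\in\mathcal L}\log(1+\log N_\ell(t))+|\mathcal L|\,\mathcal C_{\exp}\!\Big(\tfrac{\log(1/\delta)}{|\mathcal L|}\Big),\qquad \mathcal C_{\exp}(x)=2\tilde h\Big(\tfrac{h^{-1}(1+x)+\log(\pi^2/3)}2\Big),$$ $h(x)=x-\log x$ with inverse $h^{-1}:[1,\infty)\to[1,\infty)$, and $\tilde h(x)=e^{1/h^{-1}(x)}h^{-1}(x)$ if $x\ge h(1/\log\frac32)$, $\tilde h(x)=\frac32(x-\log\log\frac32)$ otherwise. **Theorem.** Suppose that $V_{s_0}(\mu)\ne\theta$ and that the maximizer $w(\mu)$ is unique. Then $d_{s_0}(\mu)>0$ and $$\limsup_{\delta\to+0}\frac{\mathbb E[\tau_\delta]}{\log(1/\delta)}\le\frac1{d_{s_0}(\mu)} .$$ -/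

import Mathlib

open MeasureTheory ProbabilityTheory Filter Topology
open scoped ENNReal

noncomputable section

namespace ThresholdMCTS

/-! ### One-parameter exponential families

A reference measure `ν` on `ℝ` generates the family of the laws `P_η` with
`dP_η / dν (x) = exp (η x - b(η))`, where `b` is the normalisation and `η` ranges over the
(interior of the) natural parameter space. -/

/-- The interior of the natural parameter space `{η | ∫ exp (η x) dν(x) < ∞}`. -/
def naturalParams (ν : Measure ℝ) : Set ℝ := interior (integrableExpSet id ν)

/-- The member of the exponential family with natural parameter `η`. -/
def expFamily (ν : Measure ℝ) (η : ℝ) : Measure ℝ := ν.tilted (fun x => η * x)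

/-- The set of means of the members of the family. -/
def meanSpace (ν : Measure ℝ) : Set ℝ :=
  (fun η => ∫ x, x ∂(expFamily ν η)) '' naturalParams ν

open Classical in
/-- The law with mean `x`: the member of the family with mean `x` if `x` is in the mean space.
A sample mean can also be an end point of the mean space (for instance `0` or `1` for Bernoulli
rewards), where the family degenerates to the point mass at `x`. -/
def lawOfMean (ν : Measure ℝ) (x : ℝ) : Measure ℝ :=
  if h : x ∈ meanSpace ν then expFamily ν h.choose else Measure.dirac x

/-- `d(x, y)`: the Kullback-Leibler divergence between the laws with means `x` and `y`. -/
def kl (ν : Measure ℝ) (x y : ℝ) : ℝ :=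
  (InformationTheory.klDiv (lawOfMean ν x) (lawOfMean ν y)).toReal

/-! ### Trees -/

/-- Labels of internal nodes. -/
inductive Label
  | max
  | min

/-- The two possible answers. -/
inductive Answer
  | win
  | lose

/-- Finite rooted trees (given by their root) whose internal nodes carry a label and have at
least one child. -/
inductive Tree : Type
  | leaf : Tree
  | node (L : Label) (n : ℕ) (c : Fin (n + 1) → Tree) : Tree

/-- The leaves of a tree. A leaf of `node L n c` is a pair of a child `i` of the root and a leaf
of the subtree `c i`. -/
def Leaf : Tree → Type
  | .leaf => Unit
  | .node _ n c => (i : Fin (n + 1)) × Leaf (c i)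

instance Leaf.instFintype : (T : Tree) → Fintype (Leaf T)
  | .leaf => inferInstanceAs (Fintype Unit)
  | .node _ n c =>
    letI := fun i => Leaf.instFintype (c i)
    inferInstanceAs (Fintype ((i : Fin (n + 1)) × Leaf (c i)))

/-- The value of the root of `T` when the leaves have means `m`. -/
def value : (T : Tree) → (Leaf T → ℝ) → ℝ
  | .leaf, m => m ()
  | .node .max _ c, m =>
    Finset.univ.sup' Finset.univ_nonempty fun i => value (c i) fun l => m ⟨i, l⟩
  | .node .min _ c, m =>
    Finset.univ.inf' Finset.univ_nonempty fun i => value (c i) fun l => m ⟨i, l⟩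

open Classical in
/-- The root of `T` is winning if and only if its value is at least the threshold `θ`. -/
def answer (T : Tree) (θ : ℝ) (m : Leaf T → ℝ) : Answer :=
  if θ ≤ value T m then .win else .lose

/-! ### Optimal allocation -/

/-- The mean vectors on the leaves of `T` for which the answer at the root of `T` is not `a`. -/
def Alt (T : Tree) (ν : Measure ℝ) (θ : ℝ) (a : Answer) : Set (Leaf T → ℝ) :=
  {m' | (∀ l, m' l ∈ meanSpace ν) ∧ answer T θ m' ≠ a}

/-- `inf_{m' ∈ Alt} ∑_ℓ w_ℓ d(m_ℓ, m'_ℓ)`. -/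
def altInf (T : Tree) (ν : Measure ℝ) (θ : ℝ) (a : Answer) (m w : Leaf T → ℝ) : ℝ :=
  sInf ((fun m' : Leaf T → ℝ => ∑ l, w l * kl ν (m l) (m' l)) '' Alt T ν θ a)

/-- `w` is an optimal sampling proportion for the mean vector `m`. -/
def IsOptimalWeight (T : Tree) (ν : Measure ℝ) (θ : ℝ) (m w : Leaf T → ℝ) : Prop :=
  w ∈ stdSimplex ℝ (Leaf T) ∧
    IsMaxOn (altInf T ν θ (answer T θ m) m) (stdSimplex ℝ (Leaf T)) w

/-- `d_{s₀}(m) = max_{w ∈ Δ} inf_{m' ∈ Alt(m)} ∑_ℓ w_ℓ d(m_ℓ, m'_ℓ)`. -/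
def optimalValue (T : Tree) (ν : Measure ℝ) (θ : ℝ) (m : Leaf T → ℝ) : ℝ :=
  sSup (altInf T ν θ (answer T θ m) m '' stdSimplex ℝ (Leaf T))

/-! ### Sampling

`I u` is the leaf drawn in round `u = 1, 2, …` and `Y l k` is the reward returned by the draw
number `k + 1` of the leaf `l`. -/

open Classical in
/-- `N_ℓ(t)`: the number of draws of `l` in the rounds `1, …, t`. -/
def count {T : Tree} (I : ℕ → Leaf T) (t : ℕ) (l : Leaf T) : ℕ :=
  ((Finset.Icc 1 t).filter fun u => I u = l).card

/-- The sample mean of the rewards observed from `l` in the rounds `1, …, t`. -/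
def empMean {T : Tree} (Y : Leaf T → ℕ → ℝ) (I : ℕ → Leaf T) (t : ℕ) (l : Leaf T) : ℝ :=
  (∑ k ∈ Finset.range (count I t l), Y l k) / count I t l

/-- The sequence `I` of leaves follows the ratio-based D-tracking rule. In the first `|𝓛|` rounds
every leaf is drawn once. In each later round `t + 1`, a least drawn leaf is drawn if some leaf has
`N_ℓ(t) < √(t + 1) - |𝓛| / 2`, and otherwise a leaf that maximises `w_ℓ / N_ℓ(t)`, where `w` is
an optimal sampling proportion for the current sample means. Ties are broken arbitrarily. -/
structure IsRatioTracking (T : Tree) (ν : Measure ℝ) (θ : ℝ) (Y : Leaf T → ℕ → ℝ)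
    (I : ℕ → Leaf T) : Prop where
  init : ∀ l, count I (Fintype.card (Leaf T)) l = 1
  explore : ∀ t, Fintype.card (Leaf T) ≤ t →
    (∃ l, (count I t l : ℝ) < √((t : ℝ) + 1) - (Fintype.card (Leaf T) : ℝ) / 2) →
    ∀ l, count I t (I (t + 1)) ≤ count I t l
  track : ∀ t, Fintype.card (Leaf T) ≤ t →
    (¬ ∃ l, (count I t l : ℝ) < √((t : ℝ) + 1) - (Fintype.card (Leaf T) : ℝ) / 2) →
    ∃ w, IsOptimalWeight T ν θ (empMean Y I t) w ∧
      ∀ l, w l / count I t l ≤ w (I (t + 1)) / count I t (I (t + 1))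

/-! ### Stopping -/

/-- `h(x) = x - log x`. -/
def h (x : ℝ) : ℝ := x - Real.log x

/-- The inverse of the increasing bijection `h : [1, ∞) → [1, ∞)`. -/
def hInv (y : ℝ) : ℝ := Function.invFunOn h (Set.Ici 1) y

open Classical in
/-- The function `h̃`. -/
def hTilde (x : ℝ) : ℝ :=
  if h (1 / Real.log (3 / 2)) ≤ x then Real.exp (1 / hInv x) * hInv x
  else 3 / 2 * (x - Real.log (Real.log (3 / 2)))

/-- The function `𝒞_exp`. -/
def cExp (x : ℝ) : ℝ := 2 * hTilde ((hInv (1 + x) + Real.log (Real.pi ^ 2 / 3)) / 2)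

/-- The threshold `β(t, δ)`, as a function of the numbers of draws `N = (N_ℓ(t))_ℓ`. -/
def beta {T : Tree} (N : Leaf T → ℕ) (δ : ℝ) : ℝ :=
  3 * ∑ l, Real.log (1 + Real.log (N l)) +
    Fintype.card (Leaf T) * cExp (Real.log (1 / δ) / Fintype.card (Leaf T))

open Classical in
/-- The statistic `Z^GAI` of a tree whose root is a MAX node with the subtrees `c i` below it, for
numbers of draws `N` and sample means `m`: the maximum of the generalized likelihood ratio
statistics `Z_c` of the children of the root if the value of the root under `m` is at least `θ`,
and the generalized likelihood ratio statistic of the root otherwise. -/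
def glrGAI {n : ℕ} (c : Fin (n + 1) → Tree) (ν : Measure ℝ) (θ : ℝ)
    (N : Leaf (.node .max n c) → ℕ) (m : Leaf (.node .max n c) → ℝ) : ℝ :=
  if θ ≤ value (.node .max n c) m then
    Finset.univ.sup' Finset.univ_nonempty fun i =>
      altInf (c i) ν θ (answer (.node .max n c) θ m)
        (fun l => m ⟨i, l⟩) (fun l => (N ⟨i, l⟩ : ℝ))
  else
    altInf (.node .max n c) ν θ (answer (.node .max n c) θ m) m (fun l => (N l : ℝ))

/-- The stopping time `τ_δ`: the first round after the initial ones with `Z^GAI(t) ≥ β(t, δ)`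
(`∞` if there is none). It is also the total number of observed rewards. -/
def stoppingTime {n : ℕ} (c : Fin (n + 1) → Tree) (ν : Measure ℝ) (θ : ℝ)
    (Y : Leaf (.node .max n c) → ℕ → ℝ) (I : ℕ → Leaf (.node .max n c)) (δ : ℝ) : ℝ≥0∞ :=
  ⨅ t ∈ {t : ℕ | Fintype.card (Leaf (.node .max n c)) < t ∧
    beta (count I t) δ ≤ glrGAI c ν θ (count I t) (empMean Y I t)}, (t : ℝ≥0∞)

end ThresholdMCTS

end

/-! The stopping statistic grows like `t * d`, with `d` the optimal value, while the threshold is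
`log (1 / δ)` up to lower order terms; they cross near `log (1 / δ) / d`. Three facts turn this into
a bound on the expectation.

Continuity. Projecting an alternative to a compact interval around `θ` and the means keeps its
answer, since tree values commute with monotone maps, and only lowers the divergences. Hence the
infimum over alternatives is continuous in means and weights (`exists_continuous_altInf`), and
uniqueness of `w` makes the optimal weights continuous at `μ` (`eventually_isOptimalWeight`). Forced
exploration and the ratio rule then bring the proportions of draws close to `w`
(`exists_tracking_bound`).

The MAX root. At a winning root the statistic is only a maximum over the children, which could be
smaller than the statistic of the root. A losing alternative of the root is a free combination of
losing alternatives of the children, so its infimum splits into a sum, and by averaging all weight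
can be moved below one child without loss. As `w` is unique, it already sits below that child, whose
infimum therefore reaches `d` (`exists_child_optimalValue_le`).

Concentration. A deviation of the mean of the first `k` rewards of a leaf is exponentially unlikely,
while forced exploration yields `k` draws of every leaf within order `k ^ 2` rounds. So the time
after which all sample means are good is bounded by a variable of finite expectation that does not
depend on `δ` (`lintegral_badTime_ne_top`). Counting draws instead of rounds removes the adaptive
sampling rule from the probability estimate. `exists_stoppingTime_le` combines everything on each
path. -/

namespace ThresholdMCTS

/-! ### Means, natural parameters and divergences in the exponential family -/

section ExponentialFamily

variable {ν : Measure ℝ}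

open Classical in
/-- The natural parameter of the member of the family with mean `x`. -/
noncomputable def natParam (ν : Measure ℝ) (x : ℝ) : ℝ :=
  if h : x ∈ meanSpace ν then h.choose else 0

lemma natParam_mem {x : ℝ} (hx : x ∈ meanSpace ν) : natParam ν x ∈ naturalParams ν := by
  rw [natParam, dif_pos hx]
  exact hx.choose_spec.1

lemma integral_expFamily_natParam {x : ℝ} (hx : x ∈ meanSpace ν) :
    ∫ z, z ∂(expFamily ν (natParam ν x)) = x := by
  rw [natParam, dif_pos hx]
  exact hx.choose_spec.2

lemma lawOfMean_eq {x : ℝ} (hx : x ∈ meanSpace ν) :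
    lawOfMean ν x = expFamily ν (natParam ν x) := by
  rw [natParam, lawOfMean, dif_pos hx, dif_pos hx]

lemma isOpen_naturalParams : IsOpen (naturalParams ν) := isOpen_interior

lemma ordConnected_naturalParams : (naturalParams ν).OrdConnected :=
  (convex_integrableExpSet.interior).ordConnected

lemma integrable_exp_of_mem {η : ℝ} (hη : η ∈ naturalParams ν) :
    Integrable (fun x => Real.exp (η * x)) ν :=
  (interior_subset : naturalParams ν ⊆ integrableExpSet id ν) hη

lemma ne_zero_of_nontrivial (hX : (meanSpace ν).Nontrivial) : ν ≠ 0 := by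
  rintro rfl
  obtain ⟨x, ⟨a, -, rfl⟩, y, ⟨b, -, rfl⟩, hxy⟩ := hX
  simp [expFamily] at hxy

lemma isProbabilityMeasure_expFamily (hν : ν ≠ 0) {η : ℝ} (hη : η ∈ naturalParams ν) :
    IsProbabilityMeasure (expFamily ν η) :=
  have : NeZero ν := ⟨hν⟩
  isProbabilityMeasure_tilted (integrable_exp_of_mem hη)

lemma integrable_id_expFamily {η : ℝ} (hη : η ∈ naturalParams ν) :
    Integrable (fun x => x) (expFamily ν η) :=
  memLp_one_iff_integrable.1 (memLp_tilted_mul (X := id) (μ := ν) hη 1)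

lemma integral_expFamily {η : ℝ} (hη : η ∈ naturalParams ν) :
    ∫ z, z ∂(expFamily ν η) = deriv (cgf id ν) η :=
  integral_tilted_mul_self (X := id) (μ := ν) hη

lemma expFamily_eq_tilted {η η' : ℝ} (hη : η ∈ naturalParams ν) :
    expFamily ν η' = (expFamily ν η).tilted (fun x => (η' - η) * x) := by
  rw [expFamily, expFamily, tilted_tilted (integrable_exp_of_mem hη)]
  congr 1
  ext x
  simp
  ring

lemma integrable_exp_expFamily {η η' : ℝ} (hη : η ∈ naturalParams ν) (hη' : η' ∈ naturalParams ν) :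
    Integrable (fun x => Real.exp ((η' - η) * x)) (expFamily ν η) := by
  rw [expFamily, integrable_tilted_iff (integrable_exp_of_mem hη)]
  refine (integrable_exp_of_mem hη').congr (ae_of_all _ fun x => ?_)
  simp only [smul_eq_mul, ← Real.exp_add]
  congr 1
  ring

/-- One member is an exponential tilt of the other, so the log-likelihood ratio is affine and
integrates to this formula. Finiteness is recorded because `toReal` would send an infinite
divergence to `0`. -/
lemma klDiv_expFamily (hν : ν ≠ 0) {η η' : ℝ} (hη : η ∈ naturalParams ν)
    (hη' : η' ∈ naturalParams ν) :
    (InformationTheory.klDiv (expFamily ν η) (expFamily ν η')).toReal =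
        cgf id ν η' - cgf id ν η - (∫ z, z ∂(expFamily ν η)) * (η' - η) ∧
      InformationTheory.klDiv (expFamily ν η) (expFamily ν η') ≠ ∞ := by
  have := isProbabilityMeasure_expFamily hν hη
  have := isProbabilityMeasure_expFamily hν hη'
  have : NeZero ν := ⟨hν⟩
  have hexp := integrable_exp_expFamily hη hη'
  have hlin : Integrable (fun x => (η' - η) * x) (expFamily ν η) :=
    (integrable_id_expFamily hη).const_mul _
  have hself : Integrable (llr (expFamily ν η) (expFamily ν η)) (expFamily ν η) :=
    (integrable_zero _ _ _).congr (llr_self _).symm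
  have hac : expFamily ν η ≪ expFamily ν η' := by
    rw [expFamily_eq_tilted (η' := η') hη]
    exact absolutelyContinuous_tilted hexp
  have hint : Integrable (llr (expFamily ν η) (expFamily ν η')) (expFamily ν η) := by
    rw [expFamily_eq_tilted (η' := η') hη]
    exact integrable_llr_tilted_right Measure.AbsolutelyContinuous.rfl hlin hself hexp
  refine ⟨?_, InformationTheory.klDiv_ne_top hac hint⟩
  rw [InformationTheory.toReal_klDiv_of_measure_eq hac (by simp)]
  have h1 := integral_llr_tilted_right Measure.AbsolutelyContinuous.rfl hlin hexp hself
  rw [← expFamily_eq_tilted (η' := η') hη, integral_congr_ae (llr_self _)] at h1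
  rw [h1, integral_const_mul]
  have h2 : ∫ x, Real.exp ((η' - η) * x) ∂(expFamily ν η) = mgf id ν η' / mgf id ν η := by
    have := integral_exp_tilted (μ := ν) (fun x => η * x) (fun x => (η' - η) * x)
    rw [expFamily, this]
    simp only [mgf, id, Pi.add_apply]
    congr 2
    ext x
    congr 1
    ring
  rw [h2, Real.log_div (mgf_pos' (X := id) hν (integrable_exp_of_mem hη')).ne'
    (mgf_pos' (X := id) hν (integrable_exp_of_mem hη)).ne']
  simp only [cgf, Pi.zero_apply, integral_zero]
  ring

lemma kl_nonneg (x y : ℝ) : 0 ≤ kl ν x y := ENNReal.toReal_nonneg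

lemma kl_eq (hX : (meanSpace ν).Nontrivial) {x y : ℝ} (hx : x ∈ meanSpace ν)
    (hy : y ∈ meanSpace ν) :
    kl ν x y = cgf id ν (natParam ν y) - cgf id ν (natParam ν x)
      - x * (natParam ν y - natParam ν x) := by
  rw [kl, lawOfMean_eq hx, lawOfMean_eq hy,
    (klDiv_expFamily (ne_zero_of_nontrivial hX) (natParam_mem hx) (natParam_mem hy)).1,
    integral_expFamily_natParam hx]

lemma eq_of_kl_eq_zero (hX : (meanSpace ν).Nontrivial) {x y : ℝ} (hx : x ∈ meanSpace ν)
    (hy : y ∈ meanSpace ν) (h0 : kl ν x y = 0) : x = y := by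
  have hν := ne_zero_of_nontrivial hX
  have := isProbabilityMeasure_expFamily hν (natParam_mem hx)
  have := isProbabilityMeasure_expFamily hν (natParam_mem hy)
  rw [kl, lawOfMean_eq hx, lawOfMean_eq hy, ENNReal.toReal_eq_zero_iff] at h0
  have h1 := InformationTheory.klDiv_eq_zero_iff.1 (h0.resolve_right
    (klDiv_expFamily hν (natParam_mem hx) (natParam_mem hy)).2)
  rw [← integral_expFamily_natParam hx, h1, integral_expFamily_natParam hy]

lemma kl_pos (hX : (meanSpace ν).Nontrivial) {x y : ℝ} (hx : x ∈ meanSpace ν)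
    (hy : y ∈ meanSpace ν) (hxy : x ≠ y) : 0 < kl ν x y :=
  (kl_nonneg x y).lt_of_ne' fun h => hxy (eq_of_kl_eq_zero hX hx hy h)

/-- The symmetrised divergence `kl ν x y + kl ν y x` equals `(y - x) * (natParam ν y - natParam ν
x)` and is positive. -/
lemma strictMonoOn_natParam (hX : (meanSpace ν).Nontrivial) :
    StrictMonoOn (natParam ν) (meanSpace ν) := by
  intro x hx y hy hxy
  have h1 := kl_pos hX hx hy hxy.ne
  have h2 := kl_pos hX hy hx hxy.ne'
  rw [kl_eq hX hx hy] at h1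
  rw [kl_eq hX hy hx] at h2
  nlinarith

/-- Two different natural parameters give two different means, unless all means agree. -/
lemma injOn_mean (hX : (meanSpace ν).Nontrivial) :
    Set.InjOn (fun η => ∫ x, x ∂(expFamily ν η)) (naturalParams ν) := by
  intro η hη η' hη' heq
  by_contra hne
  have hν := ne_zero_of_nontrivial hX
  have := isProbabilityMeasure_expFamily hν hη
  have := isProbabilityMeasure_expFamily hν hη'
  obtain ⟨h1, h1'⟩ := klDiv_expFamily hν hη hη'
  obtain ⟨h2, h2'⟩ := klDiv_expFamily hν hη' hη
  -- For equal means the two divergences are negatives of each other, so both vanish.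
  have h0 : (InformationTheory.klDiv (expFamily ν η) (expFamily ν η')).toReal = 0 := by
    have a1 := ENNReal.toReal_nonneg
      (a := InformationTheory.klDiv (expFamily ν η) (expFamily ν η'))
    have a2 := ENNReal.toReal_nonneg
      (a := InformationTheory.klDiv (expFamily ν η') (expFamily ν η))
    simp only at heq
    rw [heq] at h1
    linarith
  have hmeas : expFamily ν η = expFamily ν η' :=
    InformationTheory.klDiv_eq_zero_iff.1
      (((ENNReal.toReal_eq_zero_iff _).1 h0).resolve_right h1')
  have hrn := Measure.rnDeriv_self (expFamily ν η)
  have hexp := integrable_exp_expFamily hη hη'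
  have hlog := log_rnDeriv_tilted_left_self hexp
  rw [← expFamily_eq_tilted hη, ← hmeas] at hlog
  -- The log-density between the members is affine with slope `η' - η ≠ 0` and vanishes almost
  -- everywhere. So the law is a point mass, and then so is every member, against `hX`.
  obtain ⟨C, hC⟩ : ∃ C : ℝ, ∀ᵐ x ∂(expFamily ν η), x = C := by
    refine ⟨Real.log (∫ x, Real.exp ((η' - η) * x) ∂(expFamily ν η)) / (η' - η), ?_⟩
    filter_upwards [hrn, hlog] with x hx hx'
    rw [hx] at hx'
    simp only [ENNReal.toReal_one, Real.log_one] at hx'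
    rw [eq_div_iff (sub_ne_zero.2 (Ne.symm hne))]
    linarith
  have hall : ∀ x ∈ meanSpace ν, x = C := by
    rintro x ⟨ξ, hξ, rfl⟩
    have := isProbabilityMeasure_expFamily hν hξ
    have : ∀ᵐ z ∂(expFamily ν ξ), z = C := by
      rw [expFamily_eq_tilted (η' := ξ) hη]
      exact (tilted_absolutelyContinuous _ _).ae_le hC
    simp only
    rw [integral_congr_ae this]
    simp
  obtain ⟨x, hx, y, hy, hxy⟩ := hX
  exact hxy ((hall x hx).trans (hall y hy).symm)

lemma natParam_mean (hX : (meanSpace ν).Nontrivial) {η : ℝ} (hη : η ∈ naturalParams ν) :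
    natParam ν (∫ x, x ∂(expFamily ν η)) = η := by
  have hx : (∫ x, x ∂(expFamily ν η)) ∈ meanSpace ν := ⟨η, hη, rfl⟩
  exact injOn_mean hX (natParam_mem hx) hη (integral_expFamily_natParam hx)

lemma image_natParam (hX : (meanSpace ν).Nontrivial) :
    natParam ν '' meanSpace ν = naturalParams ν := by
  ext η
  constructor
  · rintro ⟨x, hx, rfl⟩
    exact natParam_mem hx
  · exact fun hη => ⟨_, ⟨η, hη, rfl⟩, natParam_mean hX hη⟩

lemma meanSpace_eq_image_deriv : meanSpace ν = deriv (cgf id ν) '' naturalParams ν :=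
  Set.image_congr fun _ hη => integral_expFamily hη

lemma continuousOn_deriv_cgf : ContinuousOn (deriv (cgf id ν)) (naturalParams ν) :=
  fun _ hη => (analyticAt_cgf (X := id) (μ := ν) hη).deriv.continuousAt.continuousWithinAt

lemma ordConnected_meanSpace : (meanSpace ν).OrdConnected := by
  rw [meanSpace_eq_image_deriv]
  exact (ordConnected_naturalParams.isPreconnected.image _ continuousOn_deriv_cgf).ordConnected

/-- The mean is strictly increasing in the natural parameter, so the means at `η ± ε / 2` bracket
the one at `η`, and the mean space is an interval. -/
lemma isOpen_meanSpace (hX : (meanSpace ν).Nontrivial) : IsOpen (meanSpace ν) := by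
  rw [isOpen_iff_mem_nhds]
  rintro _ ⟨η, hη, rfl⟩
  obtain ⟨ε, hε, hball⟩ := Metric.isOpen_iff.1 (isOpen_naturalParams (ν := ν)) η hη
  have key : ∀ η' ∈ naturalParams ν, η < η' →
      (∫ x, x ∂(expFamily ν η)) < ∫ x, x ∂(expFamily ν η') := by
    intro η' hη' hlt
    rw [← (strictMonoOn_natParam hX).lt_iff_lt ⟨η, hη, rfl⟩ ⟨η', hη', rfl⟩,
      natParam_mean hX hη, natParam_mean hX hη']
    exact hlt
  have key' : ∀ η' ∈ naturalParams ν, η' < η →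
      (∫ x, x ∂(expFamily ν η')) < ∫ x, x ∂(expFamily ν η) := by
    intro η' hη' hlt
    rw [← (strictMonoOn_natParam hX).lt_iff_lt ⟨η', hη', rfl⟩ ⟨η, hη, rfl⟩,
      natParam_mean hX hη, natParam_mean hX hη']
    exact hlt
  have h1 : η - ε / 2 ∈ naturalParams ν := hball (by
    rw [Metric.mem_ball, Real.dist_eq, abs_lt]; constructor <;> linarith)
  have h2 : η + ε / 2 ∈ naturalParams ν := hball (by
    rw [Metric.mem_ball, Real.dist_eq, abs_lt]; constructor <;> linarith)
  exact mem_of_superset (Icc_mem_nhds (key' _ h1 (by linarith)) (key _ h2 (by linarith)))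
    (ordConnected_meanSpace.out ⟨_, h1, rfl⟩ ⟨_, h2, rfl⟩)

lemma continuousOn_natParam (hX : (meanSpace ν).Nontrivial) :
    ContinuousOn (natParam ν) (meanSpace ν) := by
  intro x hx
  refine ContinuousAt.continuousWithinAt ?_
  refine (strictMonoOn_natParam hX).continuousAt_of_image_mem_nhds
    ((isOpen_meanSpace hX).mem_nhds hx) ?_
  rw [image_natParam hX]
  exact isOpen_naturalParams.mem_nhds (natParam_mem hx)

lemma continuousOn_kl (hX : (meanSpace ν).Nontrivial) :
    ContinuousOn (fun p : ℝ × ℝ => kl ν p.1 p.2) (meanSpace ν ×ˢ meanSpace ν) := by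
  have hb : ContinuousOn (cgf id ν) (naturalParams ν) :=
    fun _ hη => (analyticAt_cgf (X := id) (μ := ν) hη).continuousAt.continuousWithinAt
  have hη := continuousOn_natParam hX
  have hbη : ContinuousOn (fun x => cgf id ν (natParam ν x)) (meanSpace ν) :=
    hb.comp hη fun x hx => natParam_mem hx
  have h1 : Set.MapsTo Prod.fst (meanSpace ν ×ˢ meanSpace ν) (meanSpace ν) := fun p hp => hp.1
  have h2 : Set.MapsTo Prod.snd (meanSpace ν ×ˢ meanSpace ν) (meanSpace ν) := fun p hp => hp.2
  refine ContinuousOn.congr (f := fun p : ℝ × ℝ =>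
    cgf id ν (natParam ν p.2) - cgf id ν (natParam ν p.1)
      - p.1 * (natParam ν p.2 - natParam ν p.1)) ?_ fun p hp => kl_eq hX hp.1 hp.2
  exact ((hbη.comp continuousOn_snd h2).sub (hbη.comp continuousOn_fst h1)).sub
    (continuousOn_fst.mul ((hη.comp continuousOn_snd h2).sub (hη.comp continuousOn_fst h1)))

/-- The divergence `kl ν x ·` decreases towards `x`. -/
lemma kl_le_kl_of_mem_uIcc (hX : (meanSpace ν).Nontrivial) {x y z : ℝ} (hx : x ∈ meanSpace ν)
    (hy : y ∈ meanSpace ν) (hz : z ∈ Set.uIcc x y) : kl ν x z ≤ kl ν x y := by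
  -- Three-point identity: `kl ν x y - kl ν x z = kl ν z y + (z - x) * (natParam ν y - natParam ν
  -- z)`, where the product is nonnegative for `z` between `x` and `y`.
  have hzX : z ∈ meanSpace ν := ordConnected_meanSpace.uIcc_subset hx hy hz
  have h1 := kl_nonneg (ν := ν) z y
  rw [kl_eq hX hzX hy] at h1
  rw [kl_eq hX hx hzX, kl_eq hX hx hy]
  have hm := (strictMonoOn_natParam hX).monotoneOn
  rcases Set.mem_uIcc.1 hz with ⟨h2, h3⟩ | ⟨h2, h3⟩
  · have := hm hzX hy h3
    nlinarith
  · have := hm hy hzX h2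
    nlinarith

end ExponentialFamily

/-! ### Tree values and answers -/

section Trees

lemma sum_leaf_node {L : Label} {n : ℕ} {c : Fin (n + 1) → Tree} (f : Leaf (.node L n c) → ℝ) :
    ∑ l, f l = ∑ i, ∑ l : Leaf (c i), f ⟨i, l⟩ :=
  Fintype.sum_sigma f

/-- Maxima and minima commute with monotone maps. Applied to `clamp`, this makes compact
alternatives sufficient. -/
lemma value_comp (T : Tree) {g : ℝ → ℝ} (hg : Monotone g) (m : Leaf T → ℝ) :
    value T (fun l => g (m l)) = g (value T m) := by
  induction T with
  | leaf => rfl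
  | node L n c ih =>
    cases L with
    | max =>
      simp only [value, ih]
      exact (Finset.apply_sup'_eq_sup'_comp _ g fun x y => hg.map_max).symm
    | min =>
      simp only [value, ih]
      exact (Finset.apply_inf'_eq_inf'_comp _ g fun x y => hg.map_min).symm

lemma value_const (T : Tree) (x : ℝ) : value T (fun _ => x) = x :=
  value_comp T (g := fun _ => x) monotone_const (fun _ => 0)

lemma continuous_value (T : Tree) : Continuous (value T) := by
  induction T with
  | leaf => exact continuous_apply ()
  | node L n c ih =>
    cases L with
    | max =>
      exact Continuous.finset_sup'_apply _ fun i _ =>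
        (ih i).comp (continuous_pi fun l => continuous_apply (⟨i, l⟩ : Leaf (.node .max n c)))
    | min =>
      exact Continuous.finset_inf'_apply _ fun i _ =>
        (ih i).comp (continuous_pi fun l => continuous_apply (⟨i, l⟩ : Leaf (.node .min n c)))

lemma exists_value_eq (T : Tree) (m : Leaf T → ℝ) : ∃ l, value T m = m l := by
  induction T with
  | leaf => exact ⟨(), rfl⟩
  | node L n c ih =>
    cases L with
    | max =>
      obtain ⟨i, -, hi⟩ := Finset.exists_mem_eq_sup' Finset.univ_nonempty
        fun i => value (c i) fun l => m ⟨i, l⟩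
      obtain ⟨l, hl⟩ := ih i fun l => m ⟨i, l⟩
      exact ⟨⟨i, l⟩, hi.trans hl⟩
    | min =>
      obtain ⟨i, -, hi⟩ := Finset.exists_mem_eq_inf' Finset.univ_nonempty
        fun i => value (c i) fun l => m ⟨i, l⟩
      obtain ⟨l, hl⟩ := ih i fun l => m ⟨i, l⟩
      exact ⟨⟨i, l⟩, hi.trans hl⟩

instance Leaf.instNonempty (T : Tree) : Nonempty (Leaf T) :=
  ⟨(exists_value_eq T fun _ => 0).choose⟩

lemma answer_eq_win {T : Tree} {θ : ℝ} {m : Leaf T → ℝ} (h : θ ≤ value T m) :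
    answer T θ m = .win := if_pos h

lemma answer_eq_lose {T : Tree} {θ : ℝ} {m : Leaf T → ℝ} (h : value T m < θ) :
    answer T θ m = .lose := if_neg h.not_ge

lemma answer_ne_win {T : Tree} {θ : ℝ} {m : Leaf T → ℝ} :
    answer T θ m ≠ .win ↔ value T m < θ := by
  simp [answer]

lemma answer_ne_lose {T : Tree} {θ : ℝ} {m : Leaf T → ℝ} :
    answer T θ m ≠ .lose ↔ θ ≤ value T m := by
  simp [answer]

end Trees

/-! ### Reduction of the alternatives to a compact box -/

section AltInf

variable {T : Tree} {ν : Measure ℝ} {θ : ℝ}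

lemma bddBelow_altInf {m w : Leaf T → ℝ} (hw : ∀ l, 0 ≤ w l) (S : Set (Leaf T → ℝ)) :
    BddBelow ((fun m' : Leaf T → ℝ => ∑ l, w l * kl ν (m l) (m' l)) '' S) := by
  refine ⟨0, ?_⟩
  rintro _ ⟨m', -, rfl⟩
  exact Finset.sum_nonneg fun l _ => mul_nonneg (hw l) (kl_nonneg _ _)

lemma altInf_le {a : Answer} {m w m' : Leaf T → ℝ} (hw : ∀ l, 0 ≤ w l) (h : m' ∈ Alt T ν θ a) :
    altInf T ν θ a m w ≤ ∑ l, w l * kl ν (m l) (m' l) :=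
  csInf_le (bddBelow_altInf hw _) ⟨m', h, rfl⟩

lemma Alt_nonempty {lo : ℝ} (hlo : lo ∈ meanSpace ν) (hloθ : lo < θ) (hθ : θ ∈ meanSpace ν)
    (a : Answer) : (Alt T ν θ a).Nonempty := by
  cases a with
  | win =>
    refine ⟨fun _ => lo, fun _ => hlo, ?_⟩
    rw [answer_ne_win, value_const]
    exact hloθ
  | lose =>
    refine ⟨fun _ => θ, fun _ => hθ, ?_⟩
    rw [answer_ne_lose, value_const]

lemma le_altInf {a : Answer} {m w : Leaf T → ℝ} {r : ℝ} (hne : (Alt T ν θ a).Nonempty)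
    (h : ∀ m' ∈ Alt T ν θ a, r ≤ ∑ l, w l * kl ν (m l) (m' l)) : r ≤ altInf T ν θ a m w := by
  refine le_csInf (hne.image _) ?_
  rintro _ ⟨m', hm', rfl⟩
  exact h m' hm'

/-- The projection of `ℝ` to `[lo, hi]`. -/
def clamp (lo hi x : ℝ) : ℝ := max lo (min hi x)

lemma monotone_clamp (lo hi : ℝ) : Monotone (clamp lo hi) := fun _ _ h =>
  max_le_max_left _ (min_le_min_left _ h)

lemma continuous_clamp (lo hi : ℝ) : Continuous (clamp lo hi) := by
  unfold clamp
  fun_prop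

lemma clamp_mem {lo hi : ℝ} (h : lo ≤ hi) (x : ℝ) : clamp lo hi x ∈ Set.Icc lo hi :=
  ⟨le_max_left _ _, max_le h (min_le_left _ _)⟩

lemma clamp_eq {lo hi x : ℝ} (h : x ∈ Set.Icc lo hi) : clamp lo hi x = x := by
  rw [clamp, min_eq_right h.2, max_eq_right h.1]

lemma clamp_mem_uIcc {lo hi x : ℝ} (h : x ∈ Set.Icc lo hi) (y : ℝ) :
    clamp lo hi y ∈ Set.uIcc x y := by
  rw [Set.mem_uIcc, clamp]
  rcases le_total x y with hxy | hxy
  · left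
    exact ⟨le_max_of_le_right (le_min h.2 hxy), max_le (h.1.trans hxy) (min_le_right _ _)⟩
  · right
    exact ⟨le_max_of_le_right (le_min (hxy.trans h.2) le_rfl), max_le h.1 (min_le_of_right_le hxy)⟩

/-- A clamped value is at least `θ` exactly when the value is. As ties count as winning, `lo` must
lie strictly below `θ`, whereas `hi = θ` is allowed. -/
lemma answer_clamp {lo hi : ℝ} (hlo : lo < θ) (hhi : θ ≤ hi) (m : Leaf T → ℝ) :
    answer T θ (fun l => clamp lo hi (m l)) = answer T θ m := by
  unfold answer
  rw [value_comp T (monotone_clamp lo hi)]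
  congr 1
  rw [clamp, le_max_iff, le_min_iff]
  simp [hlo, hhi]

/-- The alternative can be restricted to a compact box, where everything is continuous. -/
lemma exists_continuous_altInf (hX : (meanSpace ν).Nontrivial) {lo hi : ℝ}
    (hlo : lo ∈ meanSpace ν) (hhi : hi ∈ meanSpace ν) (hloθ : lo < θ) (hθhi : θ ≤ hi) (T : Tree)
    (a : Answer) :
    ∃ F : (Leaf T → ℝ) × (Leaf T → ℝ) → ℝ, Continuous F ∧
      ∀ m w : Leaf T → ℝ, (∀ l, m l ∈ Set.Icc lo hi) → (∀ l, 0 ≤ w l) →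
        altInf T ν θ a m w = F (m, w) ∧
        ∃ m' : Leaf T → ℝ, (∀ l, m' l ∈ Set.Icc lo hi) ∧
          (a = .win → value T m' ≤ θ) ∧ (a = .lose → θ ≤ value T m') ∧
          altInf T ν θ a m w = ∑ l, w l * kl ν (m l) (m' l) := by
  have hsub : Set.Icc lo hi ⊆ meanSpace ν := ordConnected_meanSpace.out hlo hhi
  have hle : lo ≤ hi := hloθ.le.trans hθhi
  have hθ : θ ∈ meanSpace ν := hsub ⟨hloθ.le, hθhi⟩
  -- The alternative to winning is given by a strict inequality, so `B` need not be closed. Passing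
  -- to the closure keeps the infimum and makes it attained, at the price of weak inequalities for
  -- the minimiser.
  set B : Set (Leaf T → ℝ) := Alt T ν θ a ∩ Set.Icc (fun _ => lo) (fun _ => hi) with hB
  have hBne : B.Nonempty := by
    obtain ⟨m', h1, h2⟩ := Alt_nonempty (T := T) hlo hloθ hθ a
    refine ⟨fun l => clamp lo hi (m' l), ⟨fun l => hsub (clamp_mem hle _), ?_⟩,
      fun l => (clamp_mem hle _).1, fun l => (clamp_mem hle _).2⟩
    rwa [answer_clamp hloθ hθhi]
  have hcl : closure B ⊆ Set.Icc (fun _ => lo) (fun _ => hi) :=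
    closure_minimal Set.inter_subset_right isClosed_Icc
  have hBc : IsCompact (closure B) := isCompact_Icc.of_isClosed_subset isClosed_closure hcl
  -- Clamping both arguments makes the objective continuous everywhere, although `kl` is only known
  -- to be continuous on the mean space; inside the box nothing changes.
  set G : ((Leaf T → ℝ) × (Leaf T → ℝ)) → (Leaf T → ℝ) → ℝ := fun p m' =>
    ∑ l, p.2 l * kl ν (clamp lo hi (p.1 l)) (clamp lo hi (m' l)) with hG
  have hk : Continuous fun p : ℝ × ℝ => kl ν (clamp lo hi p.1) (clamp lo hi p.2) := by
    refine (continuousOn_kl hX).comp_continuous (f := fun p : ℝ × ℝ =>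
      (clamp lo hi p.1, clamp lo hi p.2)) ?_ ?_
    · exact ((continuous_clamp lo hi).comp continuous_fst).prodMk
        ((continuous_clamp lo hi).comp continuous_snd)
    · exact fun p => ⟨hsub (clamp_mem hle _), hsub (clamp_mem hle _)⟩
  have hGc : Continuous ↿G := by
    refine continuous_finsetSum _ fun l _ => Continuous.mul ?_ ?_
    · exact (continuous_apply l).comp (continuous_snd.comp continuous_fst)
    · exact hk.comp (Continuous.prodMk (f := fun q : ((Leaf T → ℝ) × (Leaf T → ℝ)) ×
        (Leaf T → ℝ) => q.1.1 l) (g := fun q => q.2 l) (by fun_prop) (by fun_prop))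
  refine ⟨fun p => sInf (G p '' closure B), hBc.continuous_sInf hGc, fun m w hm hw => ?_⟩
  have hGcl : ∀ m' ∈ closure B, G (m, w) m' = ∑ l, w l * kl ν (m l) (m' l) := by
    intro m' hm'
    refine Finset.sum_congr rfl fun l _ => ?_
    simp only
    rw [clamp_eq (hm l), clamp_eq ⟨(hcl hm').1 l, (hcl hm').2 l⟩]
  have hGp : Continuous (G (m, w)) := hGc.comp (continuous_const.prodMk continuous_id)
  have heq : altInf T ν θ a m w = sInf (G (m, w) '' closure B) := by
    have himg : G (m, w) '' closure B =
        (fun m' : Leaf T → ℝ => ∑ l, w l * kl ν (m l) (m' l)) '' closure B :=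
      Set.image_congr hGcl
    have hbdd : BddBelow (G (m, w) '' closure B) := by
      rw [himg]
      exact bddBelow_altInf hw _
    apply le_antisymm
    · refine le_csInf (hBne.closure.image _) ?_
      rintro _ ⟨m', hm', rfl⟩
      refine closure_minimal (t := {m' | altInf T ν θ a m w ≤ G (m, w) m'}) (fun m' hm' => ?_)
        (isClosed_le continuous_const hGp) hm'
      rw [Set.mem_ofPred_eq, hGcl m' (subset_closure hm')]
      exact altInf_le hw hm'.1
    · refine le_altInf (Alt_nonempty hlo hloθ hθ a) fun m' hm' => ?_
      have hmem : (fun l => clamp lo hi (m' l)) ∈ B := by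
        refine ⟨⟨fun l => hsub (clamp_mem hle _), ?_⟩,
          fun l => (clamp_mem hle _).1, fun l => (clamp_mem hle _).2⟩
        rw [answer_clamp hloθ hθhi]
        exact hm'.2
      refine (csInf_le hbdd ⟨_, subset_closure hmem, rfl⟩).trans ?_
      rw [hGcl _ (subset_closure hmem)]
      exact Finset.sum_le_sum fun l _ => mul_le_mul_of_nonneg_left
        (kl_le_kl_of_mem_uIcc hX (hsub (hm l)) (hm'.1 l) (clamp_mem_uIcc (hm l) _)) (hw l)
  refine ⟨heq, ?_⟩
  obtain ⟨m', hm', hmin⟩ := hBc.exists_sInf_image_eq hBne.closure hGp.continuousOn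
  refine ⟨m', fun l => ⟨(hcl hm').1 l, (hcl hm').2 l⟩, ?_, ?_, ?_⟩
  · rintro rfl
    exact closure_minimal (t := {m | value T m ≤ θ})
      (fun m hm => (answer_ne_win.1 hm.1.2).le)
      (isClosed_le (continuous_value T) continuous_const) hm'
  · rintro rfl
    exact closure_minimal (t := {m | θ ≤ value T m})
      (fun m hm => answer_ne_lose.1 hm.1.2)
      (isClosed_le continuous_const (continuous_value T)) hm'
  · rw [heq, hmin, hGcl m' hm']

end AltInf

/-! ### The optimal value and continuity of the optimal weights -/

section Optimization

variable {T : Tree} {ν : Measure ℝ} {θ : ℝ} {μ : Leaf T → ℝ}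

lemma nontrivial_meanSpace (hθ : θ ∈ meanSpace ν) (hμ : ∀ l, μ l ∈ meanSpace ν)
    (hne : value T μ ≠ θ) : (meanSpace ν).Nontrivial := by
  obtain ⟨l, hl⟩ := exists_value_eq T μ
  exact ⟨_, hμ l, _, hθ, hl ▸ hne⟩

lemma exists_box (hX : (meanSpace ν).Nontrivial) (hθ : θ ∈ meanSpace ν)
    (hμ : ∀ l, μ l ∈ meanSpace ν) :
    ∃ lo ∈ meanSpace ν, ∃ hi ∈ meanSpace ν, lo < θ ∧ θ < hi ∧ ∀ l, lo < μ l ∧ μ l < hi := by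
  set f : Option (Leaf T) → ℝ := fun o => o.elim θ μ
  have hf : ∀ o, f o ∈ meanSpace ν := by
    rintro (_ | l)
    exacts [hθ, hμ l]
  obtain ⟨o₁, h₁⟩ := Finite.exists_min f
  obtain ⟨o₂, h₂⟩ := Finite.exists_max f
  obtain ⟨ε₁, hε₁, hb₁⟩ := Metric.isOpen_iff.1 (isOpen_meanSpace hX) _ (hf o₁)
  obtain ⟨ε₂, hε₂, hb₂⟩ := Metric.isOpen_iff.1 (isOpen_meanSpace hX) _ (hf o₂)
  have hlo : ∀ o, f o₁ - ε₁ / 2 < f o := fun o => by linarith [h₁ o]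
  have hhi : ∀ o, f o < f o₂ + ε₂ / 2 := fun o => by linarith [h₂ o]
  refine ⟨f o₁ - ε₁ / 2, hb₁ ?_, f o₂ + ε₂ / 2, hb₂ ?_, hlo none, hhi none,
    fun l => ⟨hlo (some l), hhi (some l)⟩⟩
  · rw [Metric.mem_ball, Real.dist_eq, abs_lt]
    constructor <;> linarith
  · rw [Metric.mem_ball, Real.dist_eq, abs_lt]
    constructor <;> linarith

lemma IsOptimalWeight.optimalValue_eq {m w : Leaf T → ℝ} (hw : IsOptimalWeight T ν θ m w) :
    optimalValue T ν θ m = altInf T ν θ (answer T θ m) m w := by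
  refine IsGreatest.csSup_eq ⟨⟨w, hw.1, rfl⟩, ?_⟩
  rintro _ ⟨w', hw', rfl⟩
  exact hw.2 hw'

/-- Uniform weights already give a positive value: the infimum is attained at some `m'` which
differs from `μ`, because the value of `μ` lies strictly on its own side of `θ`. -/
lemma optimalValue_pos (hθ : θ ∈ meanSpace ν) (hμ : ∀ l, μ l ∈ meanSpace ν)
    (hne : value T μ ≠ θ) {w : Leaf T → ℝ} (hw : IsOptimalWeight T ν θ μ w) :
    0 < optimalValue T ν θ μ := by
  have hX := nontrivial_meanSpace hθ hμ hne
  obtain ⟨lo, hlo, hi, hhi, hloθ, hθhi, hbox⟩ := exists_box hX hθ hμ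
  rw [hw.optimalValue_eq]
  have hcard : (0 : ℝ) < Fintype.card (Leaf T) := by exact_mod_cast Fintype.card_pos
  set u : Leaf T → ℝ := fun _ => 1 / Fintype.card (Leaf T) with hu
  have hu0 : ∀ l, 0 < u l := fun l => by positivity
  have huΔ : u ∈ stdSimplex ℝ (Leaf T) := by
    refine ⟨fun l => (hu0 l).le, ?_⟩
    rw [hu, Finset.sum_const, Finset.card_univ, nsmul_eq_mul, mul_one_div_cancel hcard.ne']
  refine lt_of_lt_of_le ?_ (hw.2 huΔ)
  obtain ⟨F, -, hF⟩ := exists_continuous_altInf hX hlo hhi hloθ hθhi.le T (answer T θ μ)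
  obtain ⟨-, m', hm', hwin, hlose, heq⟩ :=
    hF μ u (fun l => ⟨(hbox l).1.le, (hbox l).2.le⟩) fun l => (hu0 l).le
  rw [heq]
  have hsub : Set.Icc lo hi ⊆ meanSpace ν := ordConnected_meanSpace.out hlo hhi
  have hmne : μ ≠ m' := by
    rintro rfl
    rcases hne.lt_or_gt with h | h
    · exact absurd (hlose (answer_eq_lose h)) h.not_ge
    · exact absurd (hwin (answer_eq_win h.le)) h.not_ge
  obtain ⟨l, hl⟩ := Function.ne_iff.1 hmne
  exact Finset.sum_pos' (fun l _ => mul_nonneg (hu0 l).le (kl_nonneg _ _))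
    ⟨l, Finset.mem_univ _, mul_pos (hu0 l) (kl_pos hX (hμ l) (hsub (hm' l)) hl)⟩

lemma eventually_answer_eq (hne : value T μ ≠ θ) :
    ∀ᶠ m in 𝓝 μ, answer T θ m = answer T θ μ := by
  rcases hne.lt_or_gt with h | h
  · filter_upwards [(continuous_value T).continuousAt.eventually_lt_const h] with m hm
    rw [answer_eq_lose h, answer_eq_lose hm]
  · filter_upwards [(continuous_value T).continuousAt.eventually_const_lt h] with m hm
    rw [answer_eq_win h.le, answer_eq_win hm.le]

lemma eventually_mem_box {lo hi : ℝ} (hbox : ∀ l, lo < μ l ∧ μ l < hi) :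
    ∀ᶠ m in 𝓝 μ, ∀ l, m l ∈ Set.Icc lo hi := by
  refine eventually_all.2 fun l => ?_
  exact (continuous_apply l).continuousAt.eventually (Icc_mem_nhds (hbox l).1 (hbox l).2)

/-- The optimal sampling proportions depend continuously on the means, at a point where they are
unique. -/
lemma eventually_isOptimalWeight (hθ : θ ∈ meanSpace ν) (hμ : ∀ l, μ l ∈ meanSpace ν)
    (hne : value T μ ≠ θ) {w : Leaf T → ℝ} (hw : IsOptimalWeight T ν θ μ w)
    (huniq : ∀ w', IsOptimalWeight T ν θ μ w' → w' = w) {U : Set (Leaf T → ℝ)} (hU : U ∈ 𝓝 w) :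
    ∀ᶠ m in 𝓝 μ, ∀ w', IsOptimalWeight T ν θ m w' → w' ∈ U := by
  have hX := nontrivial_meanSpace hθ hμ hne
  obtain ⟨lo, hlo, hi, hhi, hloθ, hθhi, hbox⟩ := exists_box hX hθ hμ
  obtain ⟨F, hFc, hF⟩ := exists_continuous_altInf hX hlo hhi hloθ hθhi.le T (answer T θ μ)
  have hμbox : ∀ l, μ l ∈ Set.Icc lo hi := fun l => ⟨(hbox l).1.le, (hbox l).2.le⟩
  have hcomp : IsCompact (stdSimplex ℝ (Leaf T) \ interior U) :=
    (isCompact_stdSimplex ℝ (Leaf T)).diff isOpen_interior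
  -- Uniqueness makes every weight outside `U` strictly worse at `μ`. Compactness of the rest of the
  -- simplex gives one neighbourhood of `μ` that works for all of them.
  have hlt : ∀ w' ∈ stdSimplex ℝ (Leaf T) \ interior U,
      ∀ᶠ p : (Leaf T → ℝ) × (Leaf T → ℝ) in 𝓝 (μ, w'), F (p.1, p.2) < F (p.1, w) := by
    intro w' hw'
    have h0 : F (μ, w') < F (μ, w) := by
      rw [← (hF μ w' hμbox hw'.1.1).1, ← (hF μ w hμbox hw.1.1).1]
      refine lt_of_le_of_ne (hw.2 hw'.1) fun heq => hw'.2 ?_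
      have : IsOptimalWeight T ν θ μ w' := ⟨hw'.1, fun v hv => by
        rw [Set.mem_ofPred_eq, heq]
        exact hw.2 hv⟩
      rw [huniq w' this]
      exact mem_interior_iff_mem_nhds.2 hU
    have hc1 : ContinuousAt (fun p : (Leaf T → ℝ) × (Leaf T → ℝ) => F (p.1, p.2)) (μ, w') := by
      fun_prop
    have hc2 : ContinuousAt (fun p : (Leaf T → ℝ) × (Leaf T → ℝ) => F (p.1, w)) (μ, w') := by
      fun_prop
    exact hc1.eventually_lt hc2 h0
  filter_upwards [hcomp.eventually_forall_of_forall_eventually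
    (P := fun m w' => F (m, w') < F (m, w)) hlt, eventually_answer_eq hne,
    eventually_mem_box hbox] with m hm hans hmbox w' hw'
  by_contra hcon
  have h1 := hm w' ⟨hw'.1, fun h => hcon (interior_subset h)⟩
  have h2 := hw'.2 hw.1
  rw [Set.mem_ofPred_eq, hans, (hF m w' hmbox hw'.1.1).1, (hF m w hmbox hw.1.1).1] at h2
  exact absurd h1 h2.not_gt

lemma mul_altInf_le {a : Answer} (hne : (Alt T ν θ a).Nonempty) {m w : Leaf T → ℝ}
    (hw : ∀ l, 0 ≤ w l) {t : ℝ} (ht : 0 ≤ t) :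
    t * altInf T ν θ a m w ≤ altInf T ν θ a m (fun l => t * w l) := by
  refine le_altInf hne fun m' hm' => ?_
  simp only [mul_assoc]
  rw [← Finset.mul_sum]
  exact mul_le_mul_of_nonneg_left (altInf_le hw hm') ht

end Optimization

/-! ### The statistic at a MAX root -/

section MaxNode

variable {ν : Measure ℝ} {θ : ℝ} {n : ℕ} {c : Fin (n + 1) → Tree}

/-- The alternative to winning at a MAX node is a product over the children, which makes its infimum
additive. -/
lemma Alt_win_node_iff {m : Leaf (.node .max n c) → ℝ} :
    m ∈ Alt (.node .max n c) ν θ .win ↔ ∀ i, (fun l => m ⟨i, l⟩) ∈ Alt (c i) ν θ .win := by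
  have h1 : (∀ l, m l ∈ meanSpace ν) ↔ ∀ i (l : Leaf (c i)), m ⟨i, l⟩ ∈ meanSpace ν :=
    ⟨fun h i l => h ⟨i, l⟩, fun h l => h l.1 l.2⟩
  have h2 : value (.node .max n c) m < θ ↔ ∀ i, value (c i) (fun l => m ⟨i, l⟩) < θ := by
    simp [value, Finset.sup'_lt_iff]
  change (∀ l, m l ∈ meanSpace ν) ∧ answer (.node .max n c) θ m ≠ .win ↔
    ∀ i, (∀ l, m ⟨i, l⟩ ∈ meanSpace ν) ∧ answer (c i) θ (fun l => m ⟨i, l⟩) ≠ .win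
  simp only [answer_ne_win, h1, h2, forall_and]

lemma altInf_win_node_le {m w : Leaf (.node .max n c) → ℝ} (hw : ∀ l, 0 ≤ w l)
    (hne : ∀ i, (Alt (c i) ν θ .win).Nonempty) :
    altInf (.node .max n c) ν θ .win m w ≤
      ∑ i, altInf (c i) ν θ .win (fun l => m ⟨i, l⟩) (fun l => w ⟨i, l⟩) := by
  refine le_of_forall_pos_le_add fun ε hε => ?_
  have hδ : 0 < ε / (n + 1 : ℝ) := by positivity
  have : ∀ i, ∃ m' ∈ Alt (c i) ν θ .win, ∑ l, w ⟨i, l⟩ * kl ν (m ⟨i, l⟩) (m' l) <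
      altInf (c i) ν θ .win (fun l => m ⟨i, l⟩) (fun l => w ⟨i, l⟩) + ε / (n + 1 : ℝ) := by
    intro i
    obtain ⟨_, ⟨m', hm', rfl⟩, h⟩ := exists_lt_of_csInf_lt ((hne i).image _)
      (lt_add_of_pos_right
        (altInf (c i) ν θ .win (fun l => m ⟨i, l⟩) (fun l => w ⟨i, l⟩)) hδ)
    exact ⟨m', hm', h⟩
  choose m' hm' hlt using this
  have hmem : (fun l : Leaf (.node .max n c) => m' l.1 l.2) ∈ Alt (.node .max n c) ν θ .win :=
    Alt_win_node_iff.2 hm'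
  refine (altInf_le hw hmem).trans ?_
  rw [sum_leaf_node]
  refine (Finset.sum_le_sum fun i _ => (hlt i).le).trans ?_
  rw [Finset.sum_add_distrib, Finset.sum_const, Finset.card_univ, Fintype.card_fin, nsmul_eq_mul]
  push_cast
  rw [mul_div_cancel₀ _ (by positivity : (n + 1 : ℝ) ≠ 0)]

lemma altInf_child_le {m w : Leaf (.node .max n c) → ℝ} (hw : ∀ l, 0 ≤ w l)
    (hne : (Alt (.node .max n c) ν θ .win).Nonempty) (i : Fin (n + 1)) :
    altInf (c i) ν θ .win (fun l => m ⟨i, l⟩) (fun l => w ⟨i, l⟩) ≤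
      altInf (.node .max n c) ν θ .win m w := by
  refine le_altInf hne fun m' hm' => ?_
  refine (altInf_le (fun l => hw ⟨i, l⟩) (Alt_win_node_iff.1 hm' i)).trans ?_
  rw [sum_leaf_node]
  exact Finset.single_le_sum (f := fun i => ∑ l, w ⟨i, l⟩ * kl ν (m ⟨i, l⟩) (m' ⟨i, l⟩))
    (fun i _ => Finset.sum_nonneg fun l _ => mul_nonneg (hw _) (kl_nonneg _ _))
    (Finset.mem_univ i)

/-- A unique optimal sampling proportion of a winning MAX node only draws leaves below one child. -/
lemma exists_child_optimalValue_le {lo : ℝ} (hlo : lo ∈ meanSpace ν) (hloθ : lo < θ)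
    (hθ : θ ∈ meanSpace ν) {μ w : Leaf (.node .max n c) → ℝ} (hθμ : θ ≤ value (.node .max n c) μ)
    (hw : IsOptimalWeight (.node .max n c) ν θ μ w)
    (huniq : ∀ w', IsOptimalWeight (.node .max n c) ν θ μ w' → w' = w) :
    ∃ i, optimalValue (.node .max n c) ν θ μ ≤
      altInf (c i) ν θ .win (fun l => μ ⟨i, l⟩) (fun l => w ⟨i, l⟩) := by
  have hans := answer_eq_win hθμ
  have hne : ∀ T : Tree, (Alt T ν θ .win).Nonempty := fun T => Alt_nonempty hlo hloθ hθ .win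
  have hval := hw.optimalValue_eq
  rw [hans] at hval
  set d := optimalValue (.node .max n c) ν θ μ with hd
  set p : Fin (n + 1) → ℝ := fun i => ∑ l, w ⟨i, l⟩ with hp
  set f : Fin (n + 1) → ℝ := fun i =>
    altInf (c i) ν θ .win (fun l => μ ⟨i, l⟩) (fun l => w ⟨i, l⟩) with hf
  have hp0 : ∀ i, 0 ≤ p i := fun i => Finset.sum_nonneg fun l _ => hw.1.1 _
  have hp1 : ∑ i, p i = 1 := by
    rw [hp, ← sum_leaf_node]
    exact hw.1.2
  have hdf : ∑ i, d * p i ≤ ∑ i, f i := by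
    rw [← Finset.mul_sum, hp1, mul_one, hval]
    exact altInf_win_node_le hw.1.1 fun i => hne _
  have hf0 : ∀ i, p i = 0 → f i ≤ 0 := by
    intro i hi
    have hz := (Finset.sum_eq_zero_iff_of_nonneg fun l _ => hw.1.1 _).1 hi
    obtain ⟨m', hm'⟩ := hne (c i)
    refine (altInf_le (fun l => hw.1.1 _) hm').trans (Finset.sum_nonpos fun l hl => ?_)
    rw [hz l hl, zero_mul]
  -- Averaging: the `f i` sum to at least `d` and the masses `p i` sum to `1`, while children
  -- without mass contribute nothing positive.
  obtain ⟨i, hi, hfi⟩ : ∃ i, 0 < p i ∧ d * p i ≤ f i := by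
    by_contra! hcon
    obtain ⟨i, -, hi⟩ := Finset.exists_ne_zero_of_sum_ne_zero (hp1.trans_ne one_ne_zero)
    refine absurd hdf (not_le.2 (Finset.sum_lt_sum (fun j _ => ?_)
      ⟨i, Finset.mem_univ _, hcon i ((hp0 i).lt_of_ne' hi)⟩))
    rcases (hp0 j).eq_or_lt with h | h
    · rw [← h, mul_zero]
      exact hf0 j h.symm
    · exact (hcon j h).le
  refine ⟨i, ?_⟩
  classical
  -- All weight is moved below child `i`, keeping its proportions there. By homogeneity the value is
  -- still at least `d`, so `w'` is optimal and uniqueness gives `w' = w`.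
  set w' : Leaf (.node .max n c) → ℝ := fun l => if l.1 = i then (p i)⁻¹ * w l else 0 with hw'
  have hw'0 : ∀ l, 0 ≤ w' l := by
    intro l
    simp only [hw']
    split_ifs
    · exact mul_nonneg (inv_nonneg.2 hi.le) (hw.1.1 l)
    · exact le_rfl
  have hsum : ∀ j, ∑ l, w' ⟨j, l⟩ = if j = i then 1 else 0 := by
    intro j
    simp only [hw']
    split_ifs with h
    · subst h
      rw [← Finset.mul_sum, inv_mul_cancel₀ hi.ne']
    · simp
  have hw'Δ : w' ∈ stdSimplex ℝ (Leaf (.node .max n c)) := by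
    refine ⟨hw'0, ?_⟩
    rw [sum_leaf_node]
    simp [hsum]
  have hge : d ≤ altInf (.node .max n c) ν θ .win μ w' := by
    refine le_trans ?_ (altInf_child_le hw'0 (hne _) i)
    have : (fun l => w' ⟨i, l⟩) = fun l => (p i)⁻¹ * w ⟨i, l⟩ := by
      ext l
      simp [hw']
    rw [this]
    refine le_trans ?_ (mul_altInf_le (hne _) (fun l => hw.1.1 _) (inv_nonneg.2 hi.le))
    rw [inv_mul_eq_div, le_div_iff₀ hi]
    exact hfi
  have heq : w' = w := by
    refine huniq w' ⟨hw'Δ, fun v hv => ?_⟩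
    rw [Set.mem_ofPred_eq, hans]
    refine le_trans ?_ hge
    rw [hval, ← hans]
    exact hw.2 hv
  have hpi : p i = 1 := by
    have := hsum i
    rwa [heq, if_pos rfl] at this
  rwa [hpi, mul_one] at hfi

/-- The statistic is homogeneous in the counts, so it is controlled by `t` times a continuous
function of sample means and proportions. The counts and `t` are quantified inside the filter, so
that one neighbourhood serves all rounds. At a winning root the child carrying `w` suffices. -/
lemma eventually_le_glrGAI {μ w : Leaf (.node .max n c) → ℝ} (hθ : θ ∈ meanSpace ν)
    (hμ : ∀ l, μ l ∈ meanSpace ν) (hne : value (.node .max n c) μ ≠ θ)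
    (hw : IsOptimalWeight (.node .max n c) ν θ μ w)
    (huniq : ∀ w', IsOptimalWeight (.node .max n c) ν θ μ w' → w' = w) {d : ℝ}
    (hd : d < optimalValue (.node .max n c) ν θ μ) :
    ∀ᶠ p : (Leaf (.node .max n c) → ℝ) × (Leaf (.node .max n c) → ℝ) in 𝓝 (μ, w),
      ∀ (N : Leaf (.node .max n c) → ℕ) (t : ℝ), 0 < t → (∀ l, p.2 l = N l / t) →
        t * d ≤ glrGAI c ν θ N p.1 := by
  have hX := nontrivial_meanSpace hθ hμ hne
  obtain ⟨lo, hlo, hi, hhi, hloθ, hθhi, hbox⟩ := exists_box hX hθ hμ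
  have hμbox : ∀ l, μ l ∈ Set.Icc lo hi := fun l => ⟨(hbox l).1.le, (hbox l).2.le⟩
  have hfst := (continuous_fst (X := Leaf (.node .max n c) → ℝ)
    (Y := Leaf (.node .max n c) → ℝ)).tendsto (μ, w)
  have hbox' := hfst.eventually (eventually_mem_box hbox)
  rcases hne.lt_or_gt with h | h
  · obtain ⟨F, hFc, hF⟩ :=
      exists_continuous_altInf hX hlo hhi hloθ hθhi.le (.node .max n c) .lose
    have hd' : d < F (μ, w) := by
      rwa [hw.optimalValue_eq, answer_eq_lose h, (hF μ w hμbox hw.1.1).1] at hd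
    filter_upwards [hFc.continuousAt.eventually_const_lt hd', hbox',
      hfst.eventually ((continuous_value _).continuousAt.eventually_lt_const h)]
      with p hp hpbox hpv N t ht hN
    have hp0 : ∀ l, 0 ≤ p.2 l := fun l => by rw [hN]; positivity
    rw [glrGAI, if_neg hpv.not_ge, answer_eq_lose hpv]
    have hNeq : (fun l => (N l : ℝ)) = fun l => t * p.2 l := by
      ext l
      rw [hN, mul_div_cancel₀ _ ht.ne']
    rw [hNeq]
    refine le_trans ?_ (mul_altInf_le (Alt_nonempty hlo hloθ hθ _) hp0 ht.le)
    rw [(hF p.1 p.2 hpbox hp0).1]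
    exact mul_le_mul_of_nonneg_left hp.le ht.le
  · obtain ⟨i, hi⟩ := exists_child_optimalValue_le hlo hloθ hθ h.le hw huniq
    obtain ⟨F, hFc, hF⟩ := exists_continuous_altInf hX hlo hhi hloθ hθhi.le (c i) .win
    have hd' : d < F (fun l => μ ⟨i, l⟩, fun l => w ⟨i, l⟩) := by
      rw [← (hF _ _ (fun l => hμbox ⟨i, l⟩) fun l => hw.1.1 ⟨i, l⟩).1]
      exact hd.trans_le hi
    have hrestr : Continuous fun p : (Leaf (.node .max n c) → ℝ) × (Leaf (.node .max n c) → ℝ) =>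
        F (fun l => p.1 ⟨i, l⟩, fun l => p.2 ⟨i, l⟩) := by
      refine hFc.comp (Continuous.prodMk ?_ ?_)
      · exact continuous_pi fun l => (continuous_apply
          (⟨i, l⟩ : Leaf (.node .max n c))).comp continuous_fst
      · exact continuous_pi fun l => (continuous_apply
          (⟨i, l⟩ : Leaf (.node .max n c))).comp continuous_snd
    filter_upwards [hrestr.continuousAt.eventually_const_lt hd', hbox',
      hfst.eventually ((continuous_value _).continuousAt.eventually_const_lt h)]
      with p hp hpbox hpv N t ht hN
    have hp0 : ∀ l, 0 ≤ p.2 l := fun l => by rw [hN]; positivity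
    rw [glrGAI, if_pos hpv.le, answer_eq_win hpv.le]
    refine le_trans ?_ (Finset.le_sup' (fun i => altInf (c i) ν θ .win
      (fun l => p.1 ⟨i, l⟩) (fun l => (N ⟨i, l⟩ : ℝ))) (Finset.mem_univ i))
    have hNeq : (fun l => (N ⟨i, l⟩ : ℝ)) = fun l => t * p.2 ⟨i, l⟩ := by
      ext l
      exact ((congrArg (t * ·) (hN ⟨i, l⟩)).trans (mul_div_cancel₀ _ ht.ne')).symm
    rw [hNeq]
    refine le_trans ?_ (mul_altInf_le (Alt_nonempty hlo hloθ hθ _) (fun l => hp0 ⟨i, l⟩) ht.le)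
    rw [(hF _ _ (fun l => hpbox ⟨i, l⟩) fun l => hp0 ⟨i, l⟩).1]
    exact mul_le_mul_of_nonneg_left hp.le ht.le

end MaxNode

/-! ### Forced exploration and convergence of the proportions of draws -/

section Tracking

variable {T : Tree} {I : ℕ → Leaf T}

open Classical in
lemma count_succ (t : ℕ) (l : Leaf T) :
    count I (t + 1) l = count I t l + if I (t + 1) = l then 1 else 0 := by
  have : Finset.Icc 1 (t + 1) = insert (t + 1) (Finset.Icc 1 t) := by
    ext u
    simp
    omega
  rw [count, this, Finset.filter_insert]
  split_ifs with h
  · rw [Finset.card_insert_of_notMem (by simp)]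
    rfl
  · rfl

lemma count_mono (l : Leaf T) : Monotone fun t => count I t l :=
  monotone_nat_of_le_succ fun t => by
    rw [count_succ]
    exact Nat.le_add_right _ _

lemma sum_count (t : ℕ) : ∑ l, count I t l = t := by
  classical
  induction t with
  | zero => simp [count]
  | succ t ih =>
    simp only [count_succ, Finset.sum_add_distrib, ih]
    simp

lemma count_le_self (t : ℕ) (l : Leaf T) : count I t l ≤ t := by
  conv_rhs => rw [← sum_count (I := I) t]
  exact Finset.single_le_sum (f := fun l => count I t l) (fun _ _ => Nat.zero_le _)
    (Finset.mem_univ l)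

variable {ν : Measure ℝ} {θ : ℝ} {Y : Leaf T → ℕ → ℝ}

lemma IsRatioTracking.one_le_count (hI : IsRatioTracking T ν θ Y I) {t : ℕ}
    (ht : Fintype.card (Leaf T) ≤ t) (l : Leaf T) : 1 ≤ count I t l :=
  (hI.init l).symm.le.trans (count_mono l ht)

/-- The forced exploration draws every leaf `M` times within a number of rounds that is quadratic
in `M`. -/
lemma IsRatioTracking.le_count (hI : IsRatioTracking T ν θ Y I) {M t : ℕ}
    (ht : (M + Fintype.card (Leaf T)) ^ 2 + Fintype.card (Leaf T) * M ≤ t) (l : Leaf T) :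
    M ≤ count I t l := by
  set K := Fintype.card (Leaf T) with hK
  have hK1 : 1 ≤ K := Fintype.card_pos
  set s := (M + K) ^ 2 with hs
  have hsK : K ≤ s := by nlinarith
  -- The sum of the counts capped at `M` is a potential: it rises every round until all counts reach
  -- `M`, and it never exceeds `K * M`.
  have key : ∀ j : ℕ, (∀ l, M ≤ count I (s + j) l) ∨ j ≤ ∑ l, min (count I (s + j) l) M := by
    intro j
    induction j with
    | zero => exact Or.inr (Nat.zero_le _)
    | succ j ih =>
      by_cases hall : ∀ l, M ≤ count I (s + j) l
      · exact Or.inl fun l => (hall l).trans (count_mono l (by omega))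
      · right
        have ih := ih.resolve_left hall
        push Not at hall
        obtain ⟨l, hl⟩ := hall
        -- From round `s` on the exploration level is at least `M`, so a leaf with fewer than `M`
        -- draws triggers exploration, and the least drawn leaf is then also below `M`.
        have hsqrt : ((M : ℝ) + K) ≤ √(((s + j : ℕ) : ℝ) + 1) := by
          apply Real.le_sqrt_of_sq_le
          rw [hs]
          push_cast
          linarith [(Nat.cast_nonneg j : (0 : ℝ) ≤ j)]
        have hexp := hI.explore (s + j) (by omega) ⟨l, by
          have h1 : (count I (s + j) l : ℝ) < M := by exact_mod_cast hl
          have h2 : (0 : ℝ) ≤ K := Nat.cast_nonneg K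
          linarith⟩ l
        refine Nat.succ_le_of_lt (ih.trans_lt ?_)
        refine Finset.sum_lt_sum (fun k _ => ?_) ⟨I (s + j + 1), Finset.mem_univ _, ?_⟩
        · exact min_le_min_right _ (count_mono k (by omega))
        · have h1 : count I (s + (j + 1)) (I (s + j + 1)) = count I (s + j) (I (s + j + 1)) + 1 := by
            rw [← add_assoc, count_succ, if_pos rfl]
          rw [h1]
          omega
  have hfull : ∀ l, M ≤ count I (s + K * M) l := by
    rcases key (K * M) with h | h
    · exact h
    · by_contra! hcon
      obtain ⟨l, hl⟩ := hcon
      have : ∑ l, min (count I (s + K * M) l) M < ∑ _l : Leaf T, M :=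
        Finset.sum_lt_sum (fun k _ => min_le_right _ _)
          ⟨l, Finset.mem_univ _, by rwa [min_eq_left hl.le]⟩
      rw [Finset.sum_const, Finset.card_univ, smul_eq_mul] at this
      exact absurd h this.not_ge
  exact (hfull l).trans (count_mono l ht)

/-- A leaf drawn by the ratio rule has not been drawn more often than it should have been. -/
lemma count_le_mul_of_ratio {N : Leaf T → ℕ} {w : Leaf T → ℝ} (hN : ∀ l, 1 ≤ N l)
    (hw : ∑ l, w l = 1) {i : Leaf T} (h : ∀ l, w l / N l ≤ w i / N i) :
    (N i : ℝ) ≤ w i * (∑ l, N l : ℕ) := by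
  have hN' : ∀ l, (0 : ℝ) < N l := fun l => by exact_mod_cast hN l
  have : ∑ l, w l * N i ≤ ∑ l, w i * N l := Finset.sum_le_sum fun l _ =>
    (div_le_div_iff₀ (hN' l) (hN' i)).1 (h l)
  rw [← Finset.sum_mul, ← Finset.mul_sum, hw, one_mul] at this
  exact_mod_cast this

/-- A count grows only when its leaf is drawn. Just before an exploration draw it is below `√(t +
1)`; before a ratio draw it is at most `t * w' l ≤ t * (w l + ε)`. The `1` pays for the draw itself
and `t₀` for the initial rounds. -/
lemma IsRatioTracking.count_le (hI : IsRatioTracking T ν θ Y I) {w : Leaf T → ℝ}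
    (hw : ∀ l, 0 ≤ w l) {ε : ℝ} (hε : 0 ≤ ε) {t₀ : ℕ} (ht₀ : Fintype.card (Leaf T) ≤ t₀)
    (hopt : ∀ t, t₀ ≤ t → ∀ w', IsOptimalWeight T ν θ (empMean Y I t) w' → ∀ l, w' l ≤ w l + ε)
    {t : ℕ} (ht : t₀ ≤ t) (l : Leaf T) :
    (count I t l : ℝ) ≤ t * w l + (t * ε + t₀ + √t + 1) := by
  induction t, ht using Nat.le_induction with
  | base =>
    have h1 : (count I t₀ l : ℝ) ≤ t₀ := by exact_mod_cast count_le_self t₀ l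
    have := hw l
    have h2 : 0 ≤ (t₀ : ℝ) * w l := by positivity
    have h3 : 0 ≤ (t₀ : ℝ) * ε := by positivity
    have h4 := Real.sqrt_nonneg (t₀ : ℝ)
    linarith
  | succ t ht ih =>
    have hwl := hw l
    have hmono : √(t : ℝ) ≤ √((t : ℝ) + 1) := Real.sqrt_le_sqrt (by linarith)
    have hs := Real.sqrt_nonneg ((t : ℝ) + 1)
    have ht0 : (0 : ℝ) ≤ t := Nat.cast_nonneg t
    have ht₀0 : (0 : ℝ) ≤ t₀ := Nat.cast_nonneg t₀
    have h1 : 0 ≤ (t : ℝ) * w l := by positivity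
    have h2 : 0 ≤ (t : ℝ) * ε := by positivity
    rw [count_succ]
    push_cast
    split_ifs with hIl
    · by_cases hex : ∃ l, (count I t l : ℝ) < √((t : ℝ) + 1) - (Fintype.card (Leaf T) : ℝ) / 2
      · obtain ⟨k, hk⟩ := hex
        have h3 := hI.explore t (ht₀.trans ht) ⟨k, hk⟩ k
        rw [hIl] at h3
        have h4 : (count I t l : ℝ) ≤ count I t k := by exact_mod_cast h3
        have h5 : (0 : ℝ) ≤ Fintype.card (Leaf T) := Nat.cast_nonneg _
        linarith
      · obtain ⟨w', hw', hr⟩ := hI.track t (ht₀.trans ht) hex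
        have h3 := count_le_mul_of_ratio (fun l => hI.one_le_count (ht₀.trans ht) l) hw'.1.2 hr
        rw [sum_count, hIl] at h3
        have h4 := mul_le_mul_of_nonneg_right (hopt t ht w' hw' l) ht0
        linarith
    · linarith

/-- The deviations `count I t l - t * w l` sum to zero, so upper bounds at all leaves give lower
bounds, with the loss of a factor `K`. `A` and `ε'` depend only on `T` and `ε`, so that `t₀` may be
random later. -/
lemma exists_tracking_bound (T : Tree) {ε : ℝ} (hε : 0 < ε) :
    ∃ A : ℕ, ∃ ε' > 0, ∀ (ν : Measure ℝ) (θ : ℝ) (Y : Leaf T → ℕ → ℝ) (I : ℕ → Leaf T)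
      (w : Leaf T → ℝ), IsRatioTracking T ν θ Y I → w ∈ stdSimplex ℝ (Leaf T) →
      ∀ t₀, Fintype.card (Leaf T) ≤ t₀ →
      (∀ t, t₀ ≤ t → ∀ w', IsOptimalWeight T ν θ (empMean Y I t) w' → ∀ l, w' l ≤ w l + ε') →
      ∀ t, A * t₀ ≤ t → t₀ ≤ t ∧ ∀ l, |(count I t l : ℝ) / t - w l| ≤ ε := by
  set K : ℝ := ((Fintype.card (Leaf T) : ℕ) : ℝ) with hK
  have hK0 : 0 < K := Nat.cast_pos.2 Fintype.card_pos
  -- Each of the four errors `t * e`, `t₀`, `√t` and `1` will be at most `e * t`, and the lower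
  -- bound multiplies their sum by `K`. For `√t` this uses `1 ≤ t₀ ≤ e ^ 2 * t`, hence the choice of
  -- `A`.
  set e : ℝ := min (ε / (4 * K)) 1 with he
  have he0 : 0 < e := lt_min (by positivity) one_pos
  obtain ⟨A, hA⟩ := exists_nat_ge (1 / e ^ 2)
  refine ⟨A, e, he0, fun ν θ Y I w hI hw t₀ ht₀ hopt t ht => ?_⟩
  have hA1 : 1 ≤ e ^ 2 * A := by
    rwa [div_le_iff₀ (by positivity), mul_comm] at hA
  have ht₀1 : (1 : ℝ) ≤ t₀ := by
    have : 1 ≤ t₀ := le_trans Fintype.card_pos ht₀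
    exact_mod_cast this
  have htA : (A : ℝ) * t₀ ≤ t := by exact_mod_cast ht
  have he1 : e ≤ 1 := min_le_right _ _
  have het : (t₀ : ℝ) ≤ e ^ 2 * t := by
    calc (t₀ : ℝ) ≤ e ^ 2 * A * t₀ := le_mul_of_one_le_left (by linarith) hA1
      _ = e ^ 2 * (A * t₀) := by ring
      _ ≤ e ^ 2 * t := by gcongr
  have ht0 : (0 : ℝ) < t := by
    by_contra! hcon
    nlinarith [sq_nonneg e]
  have he2 : e ^ 2 ≤ e := by nlinarith
  have het' : (t₀ : ℝ) ≤ e * t := het.trans (mul_le_mul_of_nonneg_right he2 ht0.le)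
  have htt : t₀ ≤ t := by
    have : (t₀ : ℝ) ≤ t := by nlinarith
    exact_mod_cast this
  refine ⟨htt, ?_⟩
  have hsq : √(t : ℝ) ≤ e * t := by
    rw [Real.sqrt_le_left (by positivity)]
    nlinarith
  have hE : ∀ l, (count I t l : ℝ) - t * w l ≤ 4 * e * t := fun l => by
    have := hI.count_le hw.1 he0.le ht₀ hopt htt l
    linarith
  have hsum : ∑ l, ((count I t l : ℝ) - t * w l) = 0 := by
    rw [Finset.sum_sub_distrib, ← Finset.mul_sum, hw.2, ← Nat.cast_sum, sum_count]
    ring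
  have hKe : K * (4 * e * t) ≤ ε * t := by
    have : e * (4 * K) ≤ ε := (le_div_iff₀ (by positivity)).1 (min_le_left _ _)
    calc K * (4 * e * t) = e * (4 * K) * t := by ring
      _ ≤ ε * t := by gcongr
  have hK1 : 1 ≤ K := Nat.one_le_cast.2 Fintype.card_pos
  intro l
  have hl : |(count I t l : ℝ) - t * w l| ≤ ε * t := by
    rw [abs_le]
    constructor
    · classical
      have h1 : ∑ k ∈ Finset.univ.erase l, ((count I t k : ℝ) - t * w k) ≤
          ∑ k : Leaf T, 4 * e * t :=
        (Finset.sum_le_sum fun k _ => hE k).trans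
          (Finset.sum_le_sum_of_subset_of_nonneg (Finset.erase_subset _ _)
            fun _ _ _ => by positivity)
      rw [Finset.sum_const, Finset.card_univ, nsmul_eq_mul] at h1
      have h2 := Finset.add_sum_erase Finset.univ
        (fun k => (count I t k : ℝ) - t * w k) (Finset.mem_univ l)
      rw [hsum] at h2
      linarith
    · have h1 : 4 * e * t ≤ K * (4 * e * t) := le_mul_of_one_le_left (by positivity) hK1
      linarith [hE l]
  have : (count I t l : ℝ) / t - w l = ((count I t l : ℝ) - t * w l) / t := by
    field_simp
  rw [this, abs_div, abs_of_pos ht0, div_le_iff₀ ht0]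
  exact hl

end Tracking

/-! ### Asymptotics of the stopping threshold -/

section Threshold

lemma hInv_spec {y : ℝ} (hy : 1 ≤ y) : 1 ≤ hInv y ∧ h (hInv y) = y := by
  have hcont : ContinuousOn h (Set.Icc 1 (2 * y)) := by
    unfold h
    refine continuousOn_id.sub (Real.continuousOn_log.mono fun x hx => ?_)
    exact (lt_of_lt_of_le one_pos hx.1).ne'
  have h1 : h 1 = 1 := by simp [h]
  -- The bracket `2 * y` works because `log y ≤ y - 1` and `log 2 < 1`.
  have h2 : y ≤ h (2 * y) := by
    have := Real.log_two_lt_d9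
    have h3 := Real.log_le_sub_one_of_pos (lt_of_lt_of_le one_pos hy)
    rw [h, Real.log_mul two_ne_zero (by linarith)]
    linarith
  obtain ⟨x, hx, hxy⟩ := intermediate_value_Icc (by linarith) hcont
    (show y ∈ Set.Icc (h 1) (h (2 * y)) from ⟨h1.symm ▸ hy, h2⟩)
  have hex : ∃ x ∈ Set.Ici (1 : ℝ), h x = y := ⟨x, hx.1, hxy⟩
  exact ⟨Function.invFunOn_mem hex, Function.invFunOn_eq hex⟩

lemma le_hInv {y : ℝ} (hy : 1 ≤ y) : y ≤ hInv y := by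
  obtain ⟨h1, h2⟩ := hInv_spec hy
  have := Real.log_nonneg h1
  rw [h] at h2
  linarith

lemma tendsto_hInv_atTop : Tendsto hInv atTop atTop :=
  tendsto_atTop_mono' atTop ((eventually_ge_atTop 1).mono fun _ hy => le_hInv hy) tendsto_id

lemma tendsto_hInv_div : Tendsto (fun y => hInv y / y) atTop (𝓝 1) := by
  have h1 : Tendsto (fun x => h x / x) atTop (𝓝 1) := by
    have h2 : Tendsto (fun x : ℝ => 1 - Real.log x / x) atTop (𝓝 (1 - 0)) :=
      tendsto_const_nhds.sub
        (Real.isLittleO_log_id_atTop.tendsto_div_nhds_zero)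
    rw [sub_zero] at h2
    refine h2.congr' ((eventually_gt_atTop 0).mono fun x hx => ?_)
    simp only [h]
    field_simp
  have h3 := ((h1.comp tendsto_hInv_atTop).inv₀ one_ne_zero)
  rw [inv_one] at h3
  refine h3.congr' ((eventually_ge_atTop 1).mono fun y hy => ?_)
  simp only [Function.comp_apply]
  rw [(hInv_spec hy).2, inv_div]

lemma tendsto_hTilde_div : Tendsto (fun y => hTilde y / y) atTop (𝓝 1) := by
  have h1 : Tendsto (fun y => Real.exp (1 / hInv y) * (hInv y / y)) atTop (𝓝 (Real.exp 0 * 1)) := by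
    refine Tendsto.mul ((Real.continuous_exp.tendsto 0).comp ?_) tendsto_hInv_div
    simp only [one_div]
    exact tendsto_inv_atTop_zero.comp tendsto_hInv_atTop
  rw [Real.exp_zero, mul_one] at h1
  refine h1.congr' ((eventually_ge_atTop (h (1 / Real.log (3 / 2)))).mono fun y hy => ?_)
  simp only [hTilde, if_pos hy, mul_div_assoc]

/-- Both `hInv` and `hTilde` are asymptotic to the identity, and the factors `2` and `1 / 2` cancel.
-/
lemma tendsto_cExp_div : Tendsto (fun x => cExp x / x) atTop (𝓝 1) := by
  set g : ℝ → ℝ := fun x => (hInv (1 + x) + Real.log (Real.pi ^ 2 / 3)) / 2 with hg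
  have hg_apply : ∀ x, g x = (hInv (1 + x) + Real.log (Real.pi ^ 2 / 3)) / 2 := fun _ => rfl
  have hadd : Tendsto (fun x : ℝ => 1 + x) atTop atTop := tendsto_atTop_add_const_left _ _ tendsto_id
  have h1 : Tendsto g atTop atTop :=
    (tendsto_atTop_add_const_right _ _ (tendsto_hInv_atTop.comp hadd)).atTop_div_const two_pos
  have hinv : Tendsto (fun x : ℝ => x⁻¹) atTop (𝓝 0) := tendsto_inv_atTop_zero
  have h2 : Tendsto (fun x => 2 * g x / x) atTop (𝓝 1) := by
    have h3 : Tendsto (fun x : ℝ => hInv (1 + x) / (1 + x) * (x⁻¹ + 1) +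
        Real.log (Real.pi ^ 2 / 3) * x⁻¹) atTop
        (𝓝 (1 * (0 + 1) + Real.log (Real.pi ^ 2 / 3) * 0)) :=
      ((tendsto_hInv_div.comp hadd).mul (hinv.add_const 1)).add (hinv.const_mul _)
    rw [zero_add, mul_one, mul_zero, add_zero] at h3
    refine h3.congr' ((eventually_gt_atTop 0).mono fun x hx => ?_)
    simp only [hg]
    have : 1 + x ≠ 0 := by positivity
    field_simp
  have h4 := (tendsto_hTilde_div.comp h1).mul h2
  rw [one_mul] at h4
  refine h4.congr' ?_
  filter_upwards [eventually_gt_atTop 0, h1.eventually_gt_atTop 0] with x hx hgx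
  simp only [Function.comp_apply]
  rw [cExp, mul_div_assoc, ← hg_apply]
  field_simp

lemma tendsto_log_one_add_log_div :
    Tendsto (fun t : ℝ => Real.log (1 + Real.log t) / t) atTop (𝓝 0) := by
  have h0 : Tendsto (fun t : ℝ => Real.log t / t) atTop (𝓝 0) :=
    Real.isLittleO_log_id_atTop.tendsto_div_nhds_zero
  refine tendsto_of_tendsto_of_tendsto_of_le_of_le' tendsto_const_nhds h0 ?_ ?_
  · filter_upwards [eventually_ge_atTop 1] with t ht
    exact div_nonneg (Real.log_nonneg (by linarith [Real.log_nonneg ht])) (by linarith)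
  · filter_upwards [eventually_ge_atTop 1] with t ht
    have := Real.log_nonneg ht
    gcongr
    linarith [Real.log_le_sub_one_of_pos (show 0 < t by linarith)]

/-- The threshold is at most `ε t + (1 + ε) log (1 / δ)` if `t` is large and `δ` is small. -/
lemma exists_beta_le (T : Tree) {ε : ℝ} (hε : 0 < ε) :
    ∃ t₁ : ℕ, ∀ᶠ δ in 𝓝[>] (0 : ℝ), ∀ t, t₁ ≤ t → ∀ N : Leaf T → ℕ, (∀ l, 1 ≤ N l) →
      (∀ l, N l ≤ t) → beta N δ ≤ ε * t + (1 + ε) * Real.log (1 / δ) := by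
  set K : ℝ := ((Fintype.card (Leaf T) : ℕ) : ℝ) with hK
  have hK0 : 0 < K := Nat.cast_pos.2 Fintype.card_pos
  have h1 := (tendsto_log_one_add_log_div.comp tendsto_natCast_atTop_atTop).eventually_le_const
    (show 0 < ε / (3 * K) by positivity)
  obtain ⟨t₁, ht₁⟩ := eventually_atTop.1 (h1.and (eventually_ge_atTop 1))
  refine ⟨t₁, ?_⟩
  have hlog : Tendsto (fun δ : ℝ => Real.log (1 / δ) / K) (𝓝[>] 0) atTop := by
    have hinv : Tendsto (fun δ : ℝ => 1 / δ) (𝓝[>] 0) atTop := by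
      simpa only [one_div] using tendsto_inv_nhdsGT_zero
    exact (Real.tendsto_log_atTop.comp hinv).atTop_div_const hK0
  filter_upwards [(tendsto_cExp_div.comp hlog).eventually_le_const (show (1 : ℝ) < 1 + ε by linarith),
    hlog.eventually_gt_atTop 0] with δ hδ hδ0 t ht N hN1 hNt
  obtain ⟨h2, h3⟩ := ht₁ t ht
  simp only [Function.comp_apply] at h2 hδ
  have ht0 : (0 : ℝ) < t := by exact_mod_cast h3
  rw [div_le_iff₀ ht0] at h2
  rw [div_le_iff₀ hδ0] at hδ
  have h4 : ∑ l, Real.log (1 + Real.log (N l)) ≤ K * (ε / (3 * K) * t) := by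
    calc ∑ l, Real.log (1 + Real.log (N l)) ≤ ∑ _l : Leaf T, ε / (3 * K) * t := by
          refine Finset.sum_le_sum fun l _ => le_trans ?_ h2
          have hl1 : (1 : ℝ) ≤ N l := by exact_mod_cast hN1 l
          have hlt : (N l : ℝ) ≤ t := by exact_mod_cast hNt l
          have := Real.log_nonneg hl1
          gcongr
      _ = K * (ε / (3 * K) * t) := by
          rw [Finset.sum_const, Finset.card_univ, nsmul_eq_mul]
  have h5 : 3 * (K * (ε / (3 * K) * t)) = ε * t := by
    field_simp
  have h6 : K * ((1 + ε) * (Real.log (1 / δ) / K)) = (1 + ε) * Real.log (1 / δ) := by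
    field_simp
  rw [beta]
  have h7 := mul_le_mul_of_nonneg_left hδ hK0.le
  linarith

end Threshold

/-! ### Exponential concentration of sample means -/

section Concentration

variable {Ω : Type*} [MeasurableSpace Ω] {P : Measure Ω} [IsProbabilityMeasure P]

/-- Chernoff bound for one tail of the sums of i.i.d. random variables. -/
lemma exists_measure_sum_ge_le {Q : Measure ℝ} [IsProbabilityMeasure Q] {r : ℝ}
    (h0 : 0 ∈ interior (integrableExpSet id Q)) (hr : ∫ x, x ∂Q < r) :
    ∃ ρ : ℝ, 0 ≤ ρ ∧ ρ < 1 ∧ ∀ Z : ℕ → Ω → ℝ, (∀ k, HasLaw (Z k) Q P) → iIndepFun Z P →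
      ∀ k : ℕ, P.real {ω | k * r ≤ ∑ j ∈ Finset.range k, Z j ω} ≤ ρ ^ k := by
  -- The Chernoff factor equals `1` at `t = 0` and has slope `∫ x, x ∂Q - r < 0` there, so it is
  -- below `1` for some small `t > 0`.
  have hderiv : HasDerivAt (fun t => mgf id Q t * Real.exp (-t * r)) ((∫ x, x ∂Q) - r) 0 := by
    have h1 := hasDerivAt_mgf (X := id) (μ := Q) h0
    have h2 : HasDerivAt (fun t : ℝ => Real.exp (-t * r)) (Real.exp (-0 * r) * (-1 * r)) 0 :=
      (((hasDerivAt_id (0 : ℝ)).neg).mul_const r).exp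
    refine (h1.mul h2).congr_deriv ?_
    simp
    ring
  have hval : mgf id Q 0 * Real.exp (-0 * r) = 1 := by simp
  have hlt : ∀ᶠ t in 𝓝[>] (0 : ℝ), mgf id Q t * Real.exp (-t * r) < 1 := by
    have h1 := hderiv.hasDerivWithinAt (s := Set.Ioi 0)
    rw [hasDerivWithinAt_iff_tendsto_slope' (by simp)] at h1
    filter_upwards [h1.eventually_lt_const (sub_neg.2 hr), self_mem_nhdsWithin] with t ht ht0
    rw [slope_def_field, hval, sub_zero, div_neg_iff] at ht
    have ht0' : 0 < t := ht0
    rcases ht with h | h <;> linarith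
  have hint : ∀ᶠ t in 𝓝[>] (0 : ℝ), t ∈ integrableExpSet id Q :=
    mem_nhdsWithin_of_mem_nhds (mem_interior_iff_mem_nhds.1 h0)
  obtain ⟨t, ⟨hlt, hint⟩, ht0⟩ := ((hlt.and hint).and self_mem_nhdsWithin).exists
  have ht0' : 0 < t := ht0
  refine ⟨mgf id Q t * Real.exp (-t * r), mul_nonneg mgf_nonneg (Real.exp_pos _).le, hlt,
    fun Z hZ hind k => ?_⟩
  have hmgf : ∀ j, mgf (Z j) P t = mgf id Q t := fun j => by
    rw [← (hZ j).map_eq, mgf_id_map (hZ j).aemeasurable]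
  have hintj : ∀ j, Integrable (fun ω => Real.exp (t * Z j ω)) P := fun j => by
    have h1 : Integrable (fun x => Real.exp (t * x)) (P.map (Z j)) := by
      rw [(hZ j).map_eq]
      exact hint
    exact h1.comp_aemeasurable (hZ j).aemeasurable
  have hsum := hind.mgf_sum₀ (t := t) (fun j => (hZ j).aemeasurable) (Finset.range k)
  have hintS : Integrable (fun ω => Real.exp (t * (∑ j ∈ Finset.range k, Z j) ω)) P := by
    rw [← mgf_pos_iff, hsum]
    exact Finset.prod_pos fun j _ => mgf_pos (hintj j)
  have h1 := measure_ge_le_exp_mul_mgf (μ := P) (X := ∑ j ∈ Finset.range k, Z j) (k * r) ht0'.le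
    hintS
  rw [hsum] at h1
  simp only [hmgf, Finset.prod_const, Finset.card_range, Finset.sum_apply] at h1
  refine h1.trans_eq ?_
  rw [mul_pow, ← Real.exp_nat_mul, mul_comm]
  congr 2
  ring

end Concentration

section Deviations

variable {Ω : Type*} [MeasurableSpace Ω] {P : Measure Ω} [IsProbabilityMeasure P]

/-- The sample means of i.i.d. random variables with exponential moments deviate from the mean with
an exponentially small probability. -/
lemma exists_measure_sampleMean_le {Q : Measure ℝ} [IsProbabilityMeasure Q]
    (h0 : 0 ∈ interior (integrableExpSet id Q)) {ξ : ℝ} (hξ : 0 < ξ) :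
    ∃ ρ : ℝ, 0 ≤ ρ ∧ ρ < 1 ∧ ∀ Z : ℕ → Ω → ℝ, (∀ k, HasLaw (Z k) Q P) → iIndepFun Z P →
      ∀ k : ℕ, P.real {ω | ξ < |(∑ j ∈ Finset.range k, Z j ω) / k - ∫ x, x ∂Q|} ≤ 2 * ρ ^ k := by
  set a := ∫ x, x ∂Q with ha
  set Q' := Q.map (fun x => -x) with hQ'
  have hQ'p : IsProbabilityMeasure Q' := Measure.isProbabilityMeasure_map (by fun_prop)
  have h0' : 0 ∈ interior (integrableExpSet id Q') := by
    rw [mem_interior_iff_mem_nhds] at h0 ⊢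
    have hneg : Tendsto (fun t : ℝ => -t) (𝓝 0) (𝓝 0) := by
      simpa using (continuous_neg (G := ℝ)).tendsto 0
    filter_upwards [hneg.eventually h0] with t ht
    change Integrable (fun x => Real.exp (t * x)) Q'
    rw [hQ', integrable_map_measure (by fun_prop) (by fun_prop)]
    refine (show Integrable (fun x => Real.exp (-t * x)) Q from ht).congr (ae_of_all _ fun x => ?_)
    simp
  have ha' : ∫ x, x ∂Q' = -a := by
    rw [hQ', integral_map (by fun_prop) (by fun_prop), integral_neg]
  obtain ⟨ρ₁, h1, h1', H1⟩ := exists_measure_sum_ge_le (P := P) h0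
    (r := a + ξ) (by rw [← ha]; linarith)
  obtain ⟨ρ₂, h2, h2', H2⟩ := exists_measure_sum_ge_le (P := P) h0'
    (r := -a + ξ) (by rw [ha']; linarith)
  refine ⟨max ρ₁ ρ₂, le_max_of_le_left h1, max_lt h1' h2', fun Z hZ hind k => ?_⟩
  have hZ' : ∀ k, HasLaw (fun ω => -Z k ω) Q' P := fun k =>
    ⟨(hZ k).aemeasurable.neg, by
      rw [hQ', ← (hZ k).map_eq, AEMeasurable.map_map_of_aemeasurable (by fun_prop)
        (hZ k).aemeasurable]
      rfl⟩
  have hind' : iIndepFun (fun k ω => -Z k ω) P := hind.comp (fun _ x => -x) fun _ => measurable_neg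
  have e1 := H1 Z hZ hind k
  have e2 := H2 (fun k ω => -Z k ω) hZ' hind' k
  have hp1 : ρ₁ ^ k ≤ (max ρ₁ ρ₂) ^ k := by gcongr; exact le_max_left _ _
  have hp2 : ρ₂ ^ k ≤ (max ρ₁ ρ₂) ^ k := by gcongr; exact le_max_right _ _
  -- For `k = 0` the sample mean is the default `0 / 0 = 0`, and the claimed bound `2` is trivial.
  rcases k.eq_zero_or_pos with rfl | hk
  · have := measureReal_le_one (μ := P)
      (s := {ω | ξ < |(∑ j ∈ Finset.range 0, Z j ω) / ((0 : ℕ) : ℝ) - a|})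
    rw [pow_zero]
    linarith
  have hk' : (0 : ℝ) < k := by exact_mod_cast hk
  have hsub : {ω | ξ < |(∑ j ∈ Finset.range k, Z j ω) / k - a|} ⊆
      {ω | k * (a + ξ) ≤ ∑ j ∈ Finset.range k, Z j ω} ∪
        {ω | k * (-a + ξ) ≤ ∑ j ∈ Finset.range k, -Z j ω} := by
    intro ω hω
    rcases lt_abs.1 (show ξ < |_| from hω) with h | h
    · left
      have : a + ξ < (∑ j ∈ Finset.range k, Z j ω) / k := by linarith
      rw [lt_div_iff₀ hk'] at this
      change k * (a + ξ) ≤ ∑ j ∈ Finset.range k, Z j ω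
      linarith
    · right
      have : (∑ j ∈ Finset.range k, Z j ω) / k < a - ξ := by linarith
      rw [div_lt_iff₀ hk'] at this
      change k * (-a + ξ) ≤ ∑ j ∈ Finset.range k, -Z j ω
      rw [Finset.sum_neg_distrib]
      linarith
  linarith [(measureReal_mono (μ := P) hsub).trans (measureReal_union_le _ _)]

/-- Exponential moments of a member at `t` are those of `ν` at its natural parameter shifted by `t`,
and the natural parameters form an open set. -/
lemma zero_mem_interior_integrableExpSet {ν : Measure ℝ} {x : ℝ} (hx : x ∈ meanSpace ν) :
    0 ∈ interior (integrableExpSet id (lawOfMean ν x)) := by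
  rw [mem_interior_iff_mem_nhds, lawOfMean_eq hx]
  have hc : Tendsto (fun t => natParam ν x + t) (𝓝 0) (𝓝 (natParam ν x)) := by
    simpa using (continuous_const_add (natParam ν x)).tendsto 0
  filter_upwards [hc.eventually (isOpen_naturalParams.mem_nhds (natParam_mem hx))] with t ht
  have := integrable_exp_expFamily (natParam_mem hx) ht
  change Integrable (fun x => Real.exp (t * x)) _
  simpa using this

/-- The event that the mean of the first `k` rewards of the leaf `l` is off by more than `ξ`. -/
def badEvent {T : Tree} (Y : Leaf T → ℕ → Ω → ℝ) (μ : Leaf T → ℝ) (ξ : ℝ) (l : Leaf T) (k : ℕ) :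
    Set Ω :=
  {ω | ξ < |(∑ j ∈ Finset.range k, Y l j ω) / k - μ l|}

/-- A number of rounds after which all leaves have been drawn `M` times. -/
def exploreTime (T : Tree) (M : ℕ) : ℕ :=
  (M + Fintype.card (Leaf T)) ^ 2 + Fintype.card (Leaf T) * M

/-- A random time after which all sample means are `ξ`-close to the means. -/
noncomputable def badTime {T : Tree} (Y : Leaf T → ℕ → Ω → ℝ) (μ : Leaf T → ℝ) (ξ : ℝ) (ω : Ω) :
    ℝ≥0∞ :=
  ∑' k : ℕ, ∑ l, (badEvent Y μ ξ l k).indicator (fun _ => (exploreTime T (k + 1) : ℝ≥0∞)) ω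

lemma summable_exploreTime (T : Tree) {ρ : ℝ} (h0 : 0 ≤ ρ) (h1 : ρ < 1) :
    Summable fun k : ℕ => (exploreTime T (k + 1) : ℝ) * (2 * ρ ^ k) := by
  have hn : ‖ρ‖ < 1 := by rwa [Real.norm_eq_abs, abs_of_nonneg h0]
  set K : ℝ := ((Fintype.card (Leaf T) : ℕ) : ℝ) with hK
  have s0 := summable_pow_mul_geometric_of_norm_lt_one 0 hn
  have s1 := summable_pow_mul_geometric_of_norm_lt_one 1 hn
  have s2 := summable_pow_mul_geometric_of_norm_lt_one 2 hn
  refine (((s2.mul_left 2).add (s1.mul_left (2 * (2 * (1 + K) + K)))).add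
    (s0.mul_left (2 * ((1 + K) ^ 2 + K)))).congr fun k => ?_
  rw [exploreTime]
  push_cast
  rw [← hK]
  ring

variable {T : Tree} {ν : Measure ℝ} {μ : Leaf T → ℝ} {Y : Leaf T → ℕ → Ω → ℝ}

/-- The weights `exploreTime T (k + 1)` are quadratic in `k` and the probabilities of the bad events
are geometric. -/
lemma lintegral_badTime_ne_top (hX : (meanSpace ν).Nontrivial) (hμ : ∀ l, μ l ∈ meanSpace ν)
    (hlaw : ∀ l k, HasLaw (Y l k) (lawOfMean ν (μ l)) P)
    (hindep : iIndepFun (fun p : Leaf T × ℕ => Y p.1 p.2) P) {ξ : ℝ} (hξ : 0 < ξ) :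
    ∫⁻ ω, badTime Y μ ξ ω ∂P ≠ ∞ := by
  have hprob : ∀ l, IsProbabilityMeasure (lawOfMean ν (μ l)) := fun l => by
    rw [lawOfMean_eq (hμ l)]
    exact isProbabilityMeasure_expFamily (ne_zero_of_nontrivial hX) (natParam_mem (hμ l))
  have hmean : ∀ l, ∫ x, x ∂(lawOfMean ν (μ l)) = μ l := fun l => by
    rw [lawOfMean_eq (hμ l), integral_expFamily_natParam (hμ l)]
  have hρ : ∀ l, ∃ ρ : ℝ, 0 ≤ ρ ∧ ρ < 1 ∧ ∀ k, P.real (badEvent Y μ ξ l k) ≤ 2 * ρ ^ k := by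
    intro l
    obtain ⟨ρ, h0, h1, h2⟩ := exists_measure_sampleMean_le (P := P)
      (zero_mem_interior_integrableExpSet (hμ l)) hξ
    rw [hmean l] at h2
    exact ⟨ρ, h0, h1, h2 (Y l) (hlaw l)
      (hindep.precomp (g := fun k => (l, k)) fun _ _ h => (Prod.mk.inj h).2)⟩
  choose ρ h0 h1 h2 using hρ
  have hnull : ∀ l k, NullMeasurableSet (badEvent Y μ ξ l k) P := by
    intro l k
    have hm : AEMeasurable (fun ω => |(∑ j ∈ Finset.range k, Y l j ω) / k - μ l|) P := by
      have : AEMeasurable (fun ω => ∑ j ∈ Finset.range k, Y l j ω) P :=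
        Finset.aemeasurable_fun_sum _ fun j _ => (hlaw l j).aemeasurable
      exact ((this.div_const _).sub_const _).abs
    exact nullMeasurableSet_lt aemeasurable_const hm
  have hind : ∀ l k, AEMeasurable
      ((badEvent Y μ ξ l k).indicator fun _ => (exploreTime T (k + 1) : ℝ≥0∞)) P :=
    fun l k => aemeasurable_const.indicator₀ (hnull l k)
  unfold badTime
  rw [lintegral_tsum fun k => Finset.aemeasurable_fun_sum _ fun l _ => hind l k]
  have hle : ∀ k, ∫⁻ ω, ∑ l, (badEvent Y μ ξ l k).indicator
      (fun _ => (exploreTime T (k + 1) : ℝ≥0∞)) ω ∂P ≤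
      ENNReal.ofReal (∑ l, (exploreTime T (k + 1) : ℝ) * (2 * ρ l ^ k)) := by
    intro k
    rw [lintegral_finsetSum' _ fun l _ => hind l k, ENNReal.ofReal_sum_of_nonneg
      fun l _ => by have := h0 l; positivity]
    refine Finset.sum_le_sum fun l _ => ?_
    rw [lintegral_indicator_const₀ (hnull l k), ENNReal.ofReal_mul (Nat.cast_nonneg _),
      ENNReal.ofReal_natCast]
    gcongr
    exact (ENNReal.le_ofReal_iff_toReal_le (measure_ne_top _ _)
      (by have := h0 l; positivity)).2 (h2 l k)
  exact ne_top_of_le_ne_top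
    (summable_sum fun l _ => summable_exploreTime T (h0 l) (h1 l)).tsum_ofReal_ne_top
    (ENNReal.tsum_le_tsum hle)

end Deviations

/-- A finite sum allows only finitely many bad `k`, as each weight exceeds `k`. For the least good
`M > 0` the index `M - 1` is bad, and its weight is exactly `exploreTime T M`; this explains the
shift by one in `badTime`. -/
lemma exists_forall_notMem_badEvent {Ω : Type*} {T : Tree} {μ : Leaf T → ℝ}
    {Y : Leaf T → ℕ → Ω → ℝ} {ξ : ℝ} {ω : Ω} (hfin : badTime Y μ ξ ω ≠ ∞) :
    ∃ M : ℕ, (∀ k, M ≤ k → ∀ l, ω ∉ badEvent Y μ ξ l k) ∧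
      (exploreTime T M : ℝ≥0∞) ≤ exploreTime T 0 + badTime Y μ ξ ω := by
  have hbad : ∀ k l, ω ∈ badEvent Y μ ξ l k → (exploreTime T (k + 1) : ℝ≥0∞) ≤ badTime Y μ ξ ω := by
    intro k l hkl
    refine le_trans ?_ (ENNReal.le_tsum k)
    refine le_trans ?_ (Finset.single_le_sum (f := fun l => (badEvent Y μ ξ l k).indicator
      (fun _ => (exploreTime T (k + 1) : ℝ≥0∞)) ω) (fun _ _ => zero_le) (Finset.mem_univ l))
    simp only [Set.indicator_of_mem hkl]
    exact le_rfl
  have hex : ∃ M : ℕ, ∀ k, M ≤ k → ∀ l, ω ∉ badEvent Y μ ξ l k := by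
    obtain ⟨M, hM⟩ := ENNReal.exists_nat_gt hfin
    refine ⟨M, fun k hk l hkl => ?_⟩
    have h1 : (exploreTime T (k + 1) : ℝ≥0∞) < M := (hbad k l hkl).trans_lt hM
    have h2 : exploreTime T (k + 1) < M := by exact_mod_cast h1
    rw [exploreTime] at h2
    nlinarith
  classical
  refine ⟨Nat.find hex, Nat.find_spec hex, ?_⟩
  rcases h : Nat.find hex with _ | M
  · exact le_self_add
  · have h1 : ¬ ∀ k, M ≤ k → ∀ l, ω ∉ badEvent Y μ ξ l k := Nat.find_min hex (by omega)
    push Not at h1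
    obtain ⟨k, hk, l, hkl⟩ := h1
    have h2 : k = M := by
      by_contra hne
      exact Nat.find_spec hex k (by omega) l hkl
    subst h2
    exact (hbad k l hkl).trans le_add_self

/-! ### Pathwise bound on the stopping time -/

section StoppingTime

variable {ν : Measure ℝ} {θ : ℝ} {n : ℕ} {c : Fin (n + 1) → Tree}
  {μ w : Leaf (.node .max n c) → ℝ}

/-- Pathwise bound on the stopping time, in terms of a round `exploreTime _ M` after which the
sample means are close to the means. -/
lemma exists_stoppingTime_le (hθ : θ ∈ meanSpace ν) (hμ : ∀ l, μ l ∈ meanSpace ν)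
    (hne : value (.node .max n c) μ ≠ θ) (hw : IsOptimalWeight (.node .max n c) ν θ μ w)
    (huniq : ∀ w', IsOptimalWeight (.node .max n c) ν θ μ w' → w' = w) {ε : ℝ} (hε : 0 < ε)
    (hεd : 2 * ε < optimalValue (.node .max n c) ν θ μ) :
    ∃ ξ > 0, ∃ A C : ℕ, ∀ᶠ δ in 𝓝[>] (0 : ℝ), ∀ (Y : Leaf (.node .max n c) → ℕ → ℝ)
      (I : ℕ → Leaf (.node .max n c)), IsRatioTracking (.node .max n c) ν θ Y I →
      ∀ M : ℕ, (∀ k, M ≤ k → ∀ l, |(∑ j ∈ Finset.range k, Y l j) / k - μ l| ≤ ξ) →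
      stoppingTime c ν θ Y I δ ≤ A * exploreTime (.node .max n c) M + C +
        ENNReal.ofReal ((1 + ε) / (optimalValue (.node .max n c) ν θ μ - 2 * ε) *
          Real.log (1 / δ)) := by
  set d := optimalValue (.node .max n c) ν θ μ with hd
  obtain ⟨η, hη, hglr⟩ := Metric.eventually_nhds_iff.1
    (eventually_le_glrGAI hθ hμ hne hw huniq (show d - ε < d by linarith))
  obtain ⟨A, ε', hε', htrack⟩ := exists_tracking_bound (.node .max n c) (half_pos hη)
  have hU : {w' : Leaf (.node .max n c) → ℝ | ∀ l, w' l ≤ w l + ε'} ∈ 𝓝 w := by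
    filter_upwards [Metric.ball_mem_nhds w hε'] with w' hw' l
    have h1 := (dist_le_pi_dist w' w l).trans_lt hw'
    rw [Real.dist_eq] at h1
    linarith [(abs_lt.1 h1).2]
  obtain ⟨η', hη', hopt⟩ := Metric.eventually_nhds_iff.1
    (eventually_isOptimalWeight hθ hμ hne hw huniq hU)
  obtain ⟨t₁, hβ⟩ := exists_beta_le (.node .max n c) hε
  refine ⟨min η η' / 2, by positivity, A,
    t₁ + Fintype.card (Leaf (.node .max n c)) + 2, ?_⟩
  filter_upwards [hβ, Ioo_mem_nhdsGT one_pos] with δ hβδ hδ Y I hI M hM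
  set K := Fintype.card (Leaf (.node .max n c)) with hK
  set t₀ := exploreTime (.node .max n c) M with ht₀
  have hKt₀ : K ≤ t₀ := by
    have : 1 ≤ K := Fintype.card_pos
    rw [ht₀, exploreTime]
    nlinarith
  have hclose : ∀ t, t₀ ≤ t → dist (empMean Y I t) μ ≤ min η η' / 2 := by
    intro t ht
    rw [dist_pi_le_iff (by positivity)]
    intro l
    rw [Real.dist_eq]
    exact hM _ (hI.le_count ht l) l
  have hmin : min η η' / 2 < min η η' := half_lt_self (lt_min hη hη')
  have htr := htrack ν θ Y I w hI hw.1 t₀ hKt₀ fun t ht w' hw' =>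
    hopt ((hclose t ht).trans_lt (hmin.trans_le (min_le_right _ _))) w' hw'
  set L := Real.log (1 / δ) with hL
  have hL0 : 0 ≤ L := Real.log_nonneg ((one_le_div hδ.1).2 hδ.2.le)
  have hd2 : 0 < d - 2 * ε := by linarith
  -- This `q` solves `t * (d - ε) = ε * t + (1 + ε) * L`, where the lower bound for the statistic
  -- meets the upper bound for the threshold.
  set q := (1 + ε) / (d - 2 * ε) * L with hq
  have hq0 : 0 ≤ q := by positivity
  -- `A * t₀` is for tracking, `t₁ + K + 1` for the threshold estimate and the condition `K < t`,
  -- and `⌈q⌉₊` for the crossing.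
  set t := A * t₀ + (t₁ + K + 1) + ⌈q⌉₊ with ht
  have hqt : q ≤ t := (Nat.le_ceil q).trans (by
    rw [ht]
    push_cast
    have : (0 : ℝ) ≤ A * t₀ + (t₁ + K + 1) := by positivity
    linarith)
  obtain ⟨htt, hcount⟩ := htr t (by omega)
  have ht0 : (0 : ℝ) < t := by
    have : 0 < t := by omega
    exact_mod_cast this
  have h1 : t * (d - ε) ≤ glrGAI c ν θ (count I t) (empMean Y I t) := by
    refine hglr (y := (empMean Y I t, fun l => (count I t l : ℝ) / t)) ?_ (count I t) t ht0
      fun l => rfl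
    refine max_lt ((hclose t htt).trans_lt (hmin.trans_le (min_le_left _ _))) ?_
    refine lt_of_le_of_lt ?_ (half_lt_self hη)
    rw [dist_pi_le_iff (by positivity)]
    exact fun l => hcount l
  have h2 : beta (count I t) δ ≤ ε * t + (1 + ε) * L :=
    hβδ t (by omega) _ (fun l => hI.one_le_count (by omega) l) fun l => count_le_self t l
  have h3 : (1 + ε) * L ≤ (d - 2 * ε) * t := by
    calc (1 + ε) * L = (d - 2 * ε) * q := by
          rw [hq, ← mul_assoc, mul_div_cancel₀ _ hd2.ne']
      _ ≤ (d - 2 * ε) * t := by gcongr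
  have hτ : stoppingTime c ν θ Y I δ ≤ t :=
    iInf₂_le t ⟨by omega, by linarith⟩
  refine hτ.trans ?_
  have hceil : ((⌈q⌉₊ : ℕ) : ℝ≥0∞) ≤ 1 + ENNReal.ofReal q := by
    rw [← ENNReal.ofReal_natCast, ← ENNReal.ofReal_one, ← ENNReal.ofReal_add zero_le_one hq0]
    exact ENNReal.ofReal_le_ofReal (by linarith [(Nat.ceil_lt_add_one hq0).le])
  rw [ht]
  push_cast
  calc (A * t₀ + (t₁ + K + 1) + ⌈q⌉₊ : ℝ≥0∞)
      ≤ A * t₀ + (t₁ + K + 1) + (1 + ENNReal.ofReal q) := by gcongr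
    _ = A * t₀ + (t₁ + K + 2) + ENNReal.ofReal q := by ring

end StoppingTime

end ThresholdMCTS

/-! ### From the pathwise bound to the expectation -/

open ThresholdMCTS

theorem mainTheorem9
    {Ω : Type*} [MeasurableSpace Ω] (P : Measure Ω) [IsProbabilityMeasure P]
    -- the reference measure of the exponential family, the tree with a MAX root, the threshold
    (ν : Measure ℝ) {n : ℕ} (c : Fin (n + 1) → ThresholdMCTS.Tree)
    (θ : ℝ) (hθ : θ ∈ ThresholdMCTS.meanSpace ν)
    -- the means of the leaves
    (μ : ThresholdMCTS.Leaf (.node .max n c) → ℝ)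
    (hμ : ∀ l, μ l ∈ ThresholdMCTS.meanSpace ν)
    (hne : ThresholdMCTS.value (.node .max n c) μ ≠ θ)
    (huniq : ∃! w, ThresholdMCTS.IsOptimalWeight (.node .max n c) ν θ μ w)
    -- the rewards
    (Y : ThresholdMCTS.Leaf (.node .max n c) → ℕ → Ω → ℝ)
    (hlaw : ∀ l k, HasLaw (Y l k) (ThresholdMCTS.lawOfMean ν (μ l)) P)
    (hindep : iIndepFun
      (fun p : ThresholdMCTS.Leaf (.node .max n c) × ℕ => Y p.1 p.2) P)
    -- the leaves drawn by the algorithm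
    (I : ℕ → Ω → ThresholdMCTS.Leaf (.node .max n c))
    (hI : ∀ᵐ ω ∂P, ThresholdMCTS.IsRatioTracking (.node .max n c) ν θ
      (fun l k => Y l k ω) (fun t => I t ω)) :
    0 < ThresholdMCTS.optimalValue (.node .max n c) ν θ μ ∧
    limsup (fun δ : ℝ =>
        (∫⁻ ω, ThresholdMCTS.stoppingTime c ν θ (fun l k => Y l k ω) (fun t => I t ω) δ ∂P) /
          ENNReal.ofReal (Real.log (1 / δ))) (𝓝[>] 0)
      ≤ ENNReal.ofReal (1 / ThresholdMCTS.optimalValue (.node .max n c) ν θ μ) := by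

  obtain ⟨w, hw, huniq'⟩ := huniq
  have hd := optimalValue_pos hθ hμ hne hw
  refine ⟨hd, ?_⟩
  set d := optimalValue (.node .max n c) ν θ μ with hd_def
  have hX := nontrivial_meanSpace hθ hμ hne
  refine ENNReal.le_of_forall_pos_le_add fun γ hγ _ => ?_
  set r : ℝ := 1 / d + γ with hr
  have hγ' : (0 : ℝ) < γ := hγ
  have hd1 : 0 < 1 / d := by positivity
  rw [← ENNReal.ofReal_coe_nnreal, ← ENNReal.ofReal_add hd1.le hγ'.le, ← hr]
  obtain ⟨ε, hεr, hε, hεd⟩ : ∃ ε : ℝ, (1 + ε) / (d - 2 * ε) < r ∧ 0 < ε ∧ 2 * ε < d := by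
    have h1 : Tendsto (fun ε : ℝ => (1 + ε) / (d - 2 * ε)) (𝓝[>] 0) (𝓝 (1 / d)) := by
      have : ContinuousAt (fun ε : ℝ => (1 + ε) / (d - 2 * ε)) 0 := by
        refine ContinuousAt.div (by fun_prop) (by fun_prop) ?_
        simpa using hd.ne'
      have h2 := this.tendsto
      simp only [add_zero, mul_zero, sub_zero] at h2
      exact h2.mono_left nhdsWithin_le_nhds
    obtain ⟨ε, h2, h3⟩ := ((h1.eventually_lt_const (show 1 / d < r by linarith)).and
      (Ioo_mem_nhdsGT (half_pos hd))).exists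
    exact ⟨ε, h2, h3.1, by linarith [h3.2]⟩
  obtain ⟨ξ, hξ, A, C, hτ⟩ := exists_stoppingTime_le hθ hμ hne hw huniq' hε hεd
  rw [← hd_def] at hτ
  set q := (1 + ε) / (d - 2 * ε) with hq
  have hq0 : 0 < q := div_pos (by linarith) (by linarith)
  -- `B` is independent of `δ`, hence negligible against `log (1 / δ)`. The factor `A + 1` instead
  -- of `A` keeps the bound infinite where `badTime` is infinite, even if `A = 0`.
  set B : ℝ≥0∞ := (A + 1 : ℕ) * ∫⁻ ω, badTime Y μ ξ ω ∂P +
    (A * exploreTime (.node .max n c) 0 + C : ℕ) with hB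
  have hBtop : B ≠ ∞ := ENNReal.add_ne_top.2
    ⟨ENNReal.mul_ne_top (ENNReal.natCast_ne_top _)
      (lintegral_badTime_ne_top hX hμ hlaw hindep hξ), ENNReal.natCast_ne_top _⟩
  have hlog : Tendsto (fun δ : ℝ => Real.log (1 / δ)) (𝓝[>] 0) atTop := by
    have hinv : Tendsto (fun δ : ℝ => 1 / δ) (𝓝[>] 0) atTop := by
      simpa only [one_div] using tendsto_inv_nhdsGT_zero
    exact Real.tendsto_log_atTop.comp hinv
  refine limsup_le_of_le (by isBoundedDefault) ?_
  -- The last condition says `B ≤ (r - q) * log (1 / δ)`: the gap between `q` and `r` absorbs `B`.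
  filter_upwards [hτ, hlog.eventually_gt_atTop 0,
    hlog.eventually_ge_atTop (B.toReal / (r - q))] with δ hδ hL hBL
  set L := Real.log (1 / δ) with hL_def
  have hexp : ∫⁻ ω, stoppingTime c ν θ (fun l k => Y l k ω) (fun t => I t ω) δ ∂P ≤
      B + ENNReal.ofReal (q * L) := by
    calc ∫⁻ ω, stoppingTime c ν θ (fun l k => Y l k ω) (fun t => I t ω) δ ∂P
        ≤ ∫⁻ ω, ((A + 1 : ℕ) * badTime Y μ ξ ω +
          ((A * exploreTime (.node .max n c) 0 + C : ℕ) + ENNReal.ofReal (q * L))) ∂P := by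
          refine lintegral_mono_ae ?_
          filter_upwards [hI] with ω hω
          by_cases hfin : badTime Y μ ξ ω = ∞
          · rw [hfin, ENNReal.mul_top (by positivity), top_add]
            exact le_top
          · obtain ⟨M, hM, hM'⟩ := exists_forall_notMem_badEvent hfin
            refine (hδ _ _ hω M fun k hk l => not_lt.1 (hM k hk l)).trans ?_
            push_cast
            calc (A * exploreTime (.node .max n c) M + C + ENNReal.ofReal (q * L) : ℝ≥0∞)
                ≤ A * (exploreTime (.node .max n c) 0 + badTime Y μ ξ ω) + C +
                  ENNReal.ofReal (q * L) := by gcongr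
              _ ≤ A * (exploreTime (.node .max n c) 0 + badTime Y μ ξ ω) + C +
                  ENNReal.ofReal (q * L) + badTime Y μ ξ ω := le_self_add
              _ = (A + 1) * badTime Y μ ξ ω +
                  (A * exploreTime (.node .max n c) 0 + C + ENNReal.ofReal (q * L)) := by ring
      _ = B + ENNReal.ofReal (q * L) := by
          rw [lintegral_add_right _ measurable_const, lintegral_const, measure_univ, mul_one,
            lintegral_const_mul' _ _ (ENNReal.natCast_ne_top _), hB, add_assoc]
  refine ENNReal.div_le_of_le_mul (hexp.trans ?_)
  rw [← ENNReal.ofReal_mul (by positivity), ← ENNReal.ofReal_toReal hBtop,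
    ← ENNReal.ofReal_add ENNReal.toReal_nonneg (by positivity)]
  refine ENNReal.ofReal_le_ofReal ?_
  rw [div_le_iff₀ (by linarith)] at hBL
  linarith
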